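/- Let $n\ge 0$, let $\mathbb T^n=(\mathbb R/\mathbb Z)^n$ carry normalized Haar measure and $\mathbb Z^n$ counting measure. For $m\in\mathbb Z^n$, $w\in\mathbb T^n$ put $M_wT_mg(k)=e^{2\pi i w\cdot k}g(k-m)$ and $V_gf(m,w)=\sum_{k\in\mathbb Z^n}f(k)\overline{M_wT_mg(k)}$. For a non-zero window $\varphi\in\mathcal S(\mathbb Z^n)$, $M^p(\mathbb Z^n)$ is the space of tempered distributions (sequences of at most polynomial growth) $f$ on $\mathbb Z^n$ with $\|f\|_{M^p(\mathbb Z^n)}=\|V_\varphi f\|_{L^p(\mathbb Z^n\times\mathbb T^n)}<\infty$. Likewise, for a non-zero window $\Phi\in\mathcal S(\mathbb Z^n\times\mathbb T^n)$, $M^p(\mathbb Z^n\times\mathbb T^n)$ is the space of $\sigma\in\mathcal S'(\mathbb Z^n\times\mathbb T^n)$ with $$\|\sigma\|_{M^p(\mathbb Z^n\times\mathbb T^n)}=\|V_\Phi\sigma\|_{L^p((\mathbb Z^n\times\mathbb T^n)\times(\mathbb T^n\times\mathbb Z^n))}<\infty,\qquad V_\Phi\sigma(z,\xi)=\langle\sigma,M_\xi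 T_z\Phi\rangle ,$$ where $T_{(m,w)}\Phi(k,y)=\Phi(k-m,y-w)$ and $M_{(x,\zeta)}\Psi(k,y)=e^{2\pi i(k\cdot x+\zeta\cdot y)}\Psi(k,y)$. For $\sigma\in L^1(\mathbb Z^n\times\mathbb T^n)\cup L^\infty(\mathbb Z^n\times\mathbb T^n)$ and $f\in\ell^2(\mathbb Z^n)$ the localization operator is $$L_\sigma^{g_1,g_2}f(k)=\sum_{m\in\mathbb Z^n}\int_{\mathbb T^n}\sigma(m,w)\,V_{g_1}f(m,w)\,M_wT_mg_2(k)\,dw,\qquad k\in\mathbb Z^n .$$ **Theorem.** For all non-zero windows $\varphi\in\mathcal S(\mathbb Z^n)$, $\Phi\in\mathcal S(\mathbb Z^n\times\mathbb T^n)$ there is a constant $C>0$, depending only on $n,\varphi,\Phi$, such that for all $1<p<\infty$ and all $g_1,g_2\in M^1(\mathbb Z^n)$ the following holds. There is a linear map $\sigma\mapsto L_\sigma^{g_1,g_2}$ from $M^p(\mathbb Z^n\times\mathbb T^n)$ to $\mathcal B(\ell^2(\mathbb Z^n))$ which is given by the formula above for every $\sigma\in M^p(\mathbb Z^n\times\mathbb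 T^n)$ that is a function in $L^1\cup L^\infty$, and which satisfies $$\|L_\sigma^{g_1,g_2}\|_{\mathcal B(\ell^2(\mathbb Z^n))}\le C\,\|\sigma\|_{M^p(\mathbb Z^n\times\mathbb T^n)}\,\|g_1\|_{M^1(\mathbb Z^n)}\,\|g_2\|_{M^1(\mathbb Z^n)}\qquad\text{for all }\sigma\in M^p(\mathbb Z^n\times\mathbb T^n).$$ It is the only bounded linear map from $M^p(\mathbb Z^n\times\mathbb T^n)$ to $\mathcal B(\ell^2(\mathbb Z^n))$ that is given by the formula for those $\sigma\in M^p\cap M^1\cap M^\infty$ that are functions in $L^1\cup L^\infty$. Moreover, there are windows with $\|\varphi\|_{\ell^2(\mathbb Z^n)}=1$, $\|\Phi\|_{L^2(\mathbb Z^n\times\mathbb T^n)}=1$ and $\|\Phi\|_{L^1(\mathbb Z^n\times\mathbb T^n)}\le1$ for which all this holds with $C=1$, that is, $$\|L_\sigma^{g_1,g_2}\|_{\mathcal B(\ell^2(\mathbb Z^n))}\le\|\sigma\|_{M^p(\mathbb Z^n\times\mathbb T^n)}\,\|g_1\|_{M^1(\mathbb Z^n)}\,\|g_2\|_{M^1(\mathbb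 Z^n)}.$$ -/

import Mathlib

open MeasureTheory
open scoped ENNReal ContDiff ComplexConjugate

noncomputable section

namespace LocOp

/-- The lattice `ℤⁿ`. -/
abbrev Zn (n : ℕ) := Fin n → ℤ

/-- The torus `𝕋ⁿ = (ℝ/ℤ)ⁿ`; its characters are `UnitAddTorus.mFourier k w = e^{2πi k·w}`. -/
abbrev Tn (n : ℕ) := UnitAddTorus (Fin n)

/-- Normalized Haar measure on `𝕋ⁿ`. -/
def torusMeasure (n : ℕ) : Measure (Tn n) :=
  Measure.pi fun _ => AddCircle.haarAddCircle

/-- Counting measure times Haar measure on `ℤⁿ × 𝕋ⁿ`. -/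
def phaseMeasure (n : ℕ) : Measure (Zn n × Tn n) :=
  (Measure.count : Measure (Zn n)).prod (torusMeasure n)

/-- The measure on `(ℤⁿ × 𝕋ⁿ) × (𝕋ⁿ × ℤⁿ)`, where `𝕋ⁿ × ℤⁿ` is the dual group of `ℤⁿ × 𝕋ⁿ`. -/
def doublePhaseMeasure (n : ℕ) : Measure ((Zn n × Tn n) × (Tn n × Zn n)) :=
  (phaseMeasure n).prod ((torusMeasure n).prod (Measure.count : Measure (Zn n)))

/-! Time-frequency analysis on `ℤⁿ`. -/

/-- The Schwartz space `𝓢(ℤⁿ)` of rapidly decreasing functions. -/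
def IsSchwartz {n : ℕ} (φ : Zn n → ℂ) : Prop :=
  ∀ M : ℕ, ∃ C : ℝ, ∀ k, (1 + ‖k‖) ^ M * ‖φ k‖ ≤ C

/-- Tempered distributions on `ℤⁿ`, identified as usual with the functions of at most polynomial
growth. -/
def IsTempered {n : ℕ} (f : Zn n → ℂ) : Prop :=
  ∃ M : ℕ, ∃ C : ℝ, ∀ k, ‖f k‖ ≤ C * (1 + ‖k‖) ^ M

/-- `M_w T_m g`, for `z = (m, w)`. -/
def tfShift {n : ℕ} (z : Zn n × Tn n) (g : Zn n → ℂ) (k : Zn n) : ℂ :=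
  UnitAddTorus.mFourier k z.2 * g (k - z.1)

/-- The short-time Fourier transform `V_g f (m, w) = ∑ₖ f(k) conj (M_w T_m g (k))`. -/
def stft {n : ℕ} (g f : Zn n → ℂ) (z : Zn n × Tn n) : ℂ :=
  ∑' k, f k * conj (tfShift z g k)

/-- Membership in the modulation space `M^p(ℤⁿ)` (with window `φ`). -/
def MemMod {n : ℕ} (φ : Zn n → ℂ) (p : ℝ≥0∞) (f : Zn n → ℂ) : Prop :=
  IsTempered f ∧ MemLp (stft φ f) p (phaseMeasure n)

/-- The norm of `M^p(ℤⁿ)` (with window `φ`). -/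
def modNorm {n : ℕ} (φ : Zn n → ℂ) (p : ℝ≥0∞) (f : Zn n → ℂ) : ℝ :=
  (eLpNorm (stft φ f) p (phaseMeasure n)).toReal

/-! Time-frequency analysis on `ℤⁿ × 𝕋ⁿ`. -/

/-- The `ℤⁿ`-periodic lift to `ℝⁿ` of a function on `𝕋ⁿ`. -/
def lift {n : ℕ} (u : Tn n → ℂ) (x : Fin n → ℝ) : ℂ :=
  u fun i => (x i : UnitAddCircle)

/-- `Φ(k, ·)` is smooth on the torus for every `k`, and each of its derivatives decreases rapidly
in `k`, uniformly on the torus. -/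
def IsSchwartzZT {n : ℕ} (Φ : Zn n × Tn n → ℂ) : Prop :=
  (∀ k, ContDiff ℝ ∞ (lift fun y => Φ (k, y))) ∧
    ∀ M i : ℕ, ∃ C : ℝ, ∀ k x,
      (1 + ‖k‖) ^ M * ‖iteratedFDeriv ℝ i (lift fun y => Φ (k, y)) x‖ ≤ C

/-- The Schwartz space `𝓢(ℤⁿ × 𝕋ⁿ)`. -/
def schwartzZT (n : ℕ) : Submodule ℂ (Zn n × Tn n → ℂ) where
  carrier := {Φ | IsSchwartzZT Φ}
  zero_mem' := by
    have h0 : (lift fun _ => (0 : ℂ) : (Fin n → ℝ) → ℂ) = fun _ => 0 := rfl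
    refine ⟨fun k => ?_, fun M i => ⟨0, fun k x => ?_⟩⟩
    · simp only [Pi.zero_apply, h0]; exact contDiff_const
    · simp only [Pi.zero_apply, h0]
      rw [show (fun _ : Fin n → ℝ => (0 : ℂ)) = 0 from rfl, iteratedFDeriv_zero]
      simp
  add_mem' := by
    rintro Φ Ψ ⟨h1, h2⟩ ⟨h3, h4⟩
    have e : ∀ k, (lift fun y => (Φ + Ψ) (k, y)) =
        (lift fun y => Φ (k, y)) + (lift fun y => Ψ (k, y)) := fun k => rfl
    refine ⟨fun k => ?_, fun M i => ?_⟩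
    · rw [e]; exact (h1 k).add (h3 k)
    · obtain ⟨C, hC⟩ := h2 M i
      obtain ⟨D, hD⟩ := h4 M i
      refine ⟨C + D, fun k x => ?_⟩
      rw [e, iteratedFDeriv_add_apply ((h1 k).of_le (by exact_mod_cast le_top)).contDiffAt
        ((h3 k).of_le (by exact_mod_cast le_top)).contDiffAt]
      refine le_trans ?_ (add_le_add (hC k x) (hD k x))
      rw [← mul_add]
      exact mul_le_mul_of_nonneg_left (norm_add_le _ _) (by positivity)
  smul_mem' := by
    rintro c Φ ⟨h1, h2⟩
    have e : ∀ k, (lift fun y => (c • Φ) (k, y)) = c • (lift fun y => Φ (k, y)) := fun k => rfl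
    refine ⟨fun k => ?_, fun M i => ?_⟩
    · rw [e]; exact (h1 k).const_smul c
    · obtain ⟨C, hC⟩ := h2 M i
      refine ⟨‖c‖ * C, fun k x => ?_⟩
      rw [e, iteratedFDeriv_const_smul_apply
        ((h1 k).of_le (by exact_mod_cast le_top)).contDiffAt, norm_smul, mul_left_comm]
      exact mul_le_mul_of_nonneg_left (hC k x) (norm_nonneg _)

/-- The tempered distributions `𝓢'(ℤⁿ × 𝕋ⁿ)`: the linear functionals on `𝓢(ℤⁿ × 𝕋ⁿ)` that are
bounded by a multiple of finitely many of the seminorms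
`sup_{k,x} (1 + |k|)^N |D^i Φ(k, x)|`. -/
def temperedZT (n : ℕ) : Submodule ℂ (schwartzZT n →ₗ[ℂ] ℂ) where
  carrier := {u | ∃ N : ℕ, ∃ C : ℝ, 0 ≤ C ∧ ∀ (Φ : schwartzZT n) (B : ℝ),
    (∀ i ≤ N, ∀ k x,
      (1 + ‖k‖) ^ N * ‖iteratedFDeriv ℝ i (lift fun y => Φ.1 (k, y)) x‖ ≤ B) → ‖u Φ‖ ≤ C * B}
  zero_mem' := by
    refine ⟨0, 0, le_rfl, fun Φ B _ => by simp⟩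
  add_mem' := by
    rintro u v ⟨N, C, hC, hu⟩ ⟨N', C', hC', hv⟩
    refine ⟨max N N', C + C', by positivity, fun Φ B hB => ?_⟩
    have mono : ∀ L ≤ max N N', ∀ i ≤ L, ∀ k x,
        (1 + ‖k‖) ^ L * ‖iteratedFDeriv ℝ i (lift fun y => Φ.1 (k, y)) x‖ ≤ B := by
      intro L hL i hi k x
      refine le_trans ?_ (hB i (hi.trans hL) k x)
      exact mul_le_mul_of_nonneg_right
        (pow_le_pow_right₀ (by linarith [norm_nonneg k]) hL) (norm_nonneg _)
    calc ‖(u + v) Φ‖ ≤ ‖u Φ‖ + ‖v Φ‖ := norm_add_le _ _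
      _ ≤ C * B + C' * B := add_le_add (hu Φ B (mono N (le_max_left _ _)))
          (hv Φ B (mono N' (le_max_right _ _)))
      _ = (C + C') * B := by ring
  smul_mem' := by
    rintro c u ⟨N, C, hC, hu⟩
    refine ⟨N, ‖c‖ * C, by positivity, fun Φ B hB => ?_⟩
    rw [LinearMap.smul_apply, norm_smul, mul_assoc]
    exact mul_le_mul_of_nonneg_left (hu Φ B hB) (norm_nonneg _)

/-- `M_ξ T_z Φ (k, y) = e^{2πi (k·x + ζ·y)} Φ(k - m, y - w)`, for `z = (m, w)` in `ℤⁿ × 𝕋ⁿ` and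
`ξ = (x, ζ)` in the dual group `𝕋ⁿ × ℤⁿ`. -/
def tfShiftZT {n : ℕ} (z : Zn n × Tn n) (ξ : Tn n × Zn n) (Φ : Zn n × Tn n → ℂ)
    (q : Zn n × Tn n) : ℂ :=
  UnitAddTorus.mFourier q.1 ξ.1 * UnitAddTorus.mFourier ξ.2 q.2 * Φ (q - z)

theorem iteratedDeriv_exp_char (c : ℂ) (i : ℕ) :
    iteratedDeriv i (fun t : ℝ => Complex.exp (c * t)) = fun t : ℝ => c ^ i * Complex.exp (c * t) := by
  induction i with
  | zero => simp
  | succ i ih =>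
    rw [iteratedDeriv_succ, ih]
    funext t
    have h : HasDerivAt (fun t : ℝ => Complex.exp (c * t)) (Complex.exp (c * t) * (c * 1)) t :=
      ((Complex.ofRealCLM.hasDerivAt (x := t)).const_mul c).cexp
    rw [(h.const_mul (c ^ i)).deriv]
    ring

/-- The linear form `x ↦ ζ·x`. -/
def dotForm {n : ℕ} (ζ : Zn n) : (Fin n → ℝ) →L[ℝ] ℝ :=
  ∑ i, (ζ i : ℝ) • ContinuousLinearMap.proj i

theorem lift_mFourier {n : ℕ} (ζ : Zn n) :
    lift (fun y => UnitAddTorus.mFourier ζ y) =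
      (fun t : ℝ => Complex.exp ((2 * Real.pi * Complex.I) * t)) ∘ dotForm ζ := by
  funext x
  have hd : dotForm ζ x = ∑ i, (ζ i : ℝ) * x i := by simp [dotForm]
  simp only [lift, UnitAddTorus.mFourier, ContinuousMap.coe_mk, fourier_coe_apply, Function.comp,
    hd]
  rw [← Complex.exp_sum]
  congr 1
  push_cast
  rw [Finset.mul_sum]
  refine Finset.sum_congr rfl fun i _ => ?_
  simp
  ring

theorem contDiff_exp_char (c : ℂ) : ContDiff ℝ ∞ (fun t : ℝ => Complex.exp (c * t)) :=
  (contDiff_const.mul Complex.ofRealCLM.contDiff).cexp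

theorem contDiff_lift_mFourier {n : ℕ} (ζ : Zn n) :
    ContDiff ℝ ∞ (lift (fun y => UnitAddTorus.mFourier ζ y)) := by
  rw [lift_mFourier]
  exact (contDiff_exp_char _).comp (ContinuousLinearMap.contDiff _)

theorem bound_lift_mFourier {n : ℕ} (ζ : Zn n) (i : ℕ) : ∃ C : ℝ, 0 ≤ C ∧ ∀ x,
    ‖iteratedFDeriv ℝ i (lift (fun y => UnitAddTorus.mFourier ζ y)) x‖ ≤ C := by
  rw [lift_mFourier]
  refine ⟨‖(2 * Real.pi * Complex.I : ℂ)‖ ^ i * ∏ _j : Fin i, ‖dotForm ζ‖, by positivity, fun x => ?_⟩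
  rw [(dotForm ζ).iteratedFDeriv_comp_right (contDiff_exp_char _) x (i := i) (by exact_mod_cast le_top)]
  refine (ContinuousMultilinearMap.norm_compContinuousLinearMap_le _ _).trans ?_
  refine mul_le_mul_of_nonneg_right ?_ (by positivity)
  rw [norm_iteratedFDeriv_eq_norm_iteratedDeriv, iteratedDeriv_exp_char, norm_mul, norm_pow,
    Complex.norm_exp]
  simp

theorem IsSchwartzZT.tfShift {n : ℕ} {Φ : Zn n × Tn n → ℂ} (h : IsSchwartzZT Φ)
    (z : Zn n × Tn n) (ξ : Tn n × Zn n) : IsSchwartzZT (tfShiftZT z ξ Φ) := by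
  obtain ⟨h1, h2⟩ := h
  obtain ⟨m, w⟩ := z
  obtain ⟨b, hb⟩ : ∃ b : Fin n → ℝ, ∀ i, (b i : UnitAddCircle) = w i :=
    Classical.skolem.1 fun i => QuotientAddGroup.mk_surjective (w i)
  have e : ∀ k, (lift fun y => tfShiftZT (m, w) ξ Φ (k, y)) =
      UnitAddTorus.mFourier k ξ.1 • fun x => lift (fun y => UnitAddTorus.mFourier ξ.2 y) x *
        (fun x => lift (fun y => Φ (k - m, y)) (x - b)) x := by
    intro k
    funext x
    have hx : (fun i => ((x - b) i : UnitAddCircle)) =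
        (fun i => (x i : UnitAddCircle)) - w := by
      funext i
      simp [← hb i]
    simp only [lift, tfShiftZT, Pi.smul_apply, smul_eq_mul, Prod.mk_sub_mk, hx, mul_assoc]
  have hs : ∀ k, ContDiff ℝ ∞ (fun x => lift (fun y => Φ (k - m, y)) (x - b)) := fun k =>
    (h1 (k - m)).comp (contDiff_id.sub contDiff_const)
  have hm := contDiff_lift_mFourier ξ.2
  refine ⟨fun k => ?_, fun M i => ?_⟩
  · rw [e]
    exact (show ContDiff ℝ ∞ (fun x => lift (fun y => UnitAddTorus.mFourier ξ.2 y) x *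
      (fun x => lift (fun y => Φ (k - m, y)) (x - b)) x) from hm.mul (hs k)).const_smul
        (UnitAddTorus.mFourier k ξ.1)
  · choose A hA0 hA using bound_lift_mFourier ξ.2
    choose D hD using h2 M
    refine ⟨∑ j ∈ Finset.range (i + 1), (i.choose j : ℝ) * A j * ((1 + ‖m‖) ^ M * D (i - j)),
      fun k x => ?_⟩
    have hn : ‖UnitAddTorus.mFourier k ξ.1‖ ≤ 1 :=
      ((UnitAddTorus.mFourier k).norm_coe_le_norm ξ.1).trans_eq UnitAddTorus.mFourier_norm
    have hp : ContDiff ℝ ∞ (fun x => lift (fun y => UnitAddTorus.mFourier ξ.2 y) x *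
        (fun x => lift (fun y => Φ (k - m, y)) (x - b)) x) := hm.mul (hs k)
    rw [e, iteratedFDeriv_const_smul_apply
      ((hp.of_le (by exact_mod_cast le_top)).contDiffAt), norm_smul]
    have hmul := norm_iteratedFDeriv_mul_le hm (hs k) x (n := i) (by exact_mod_cast le_top)
    have hk : (1 + ‖k‖) ^ M ≤ (1 + ‖m‖) ^ M * (1 + ‖k - m‖) ^ M := by
      rw [← mul_pow]
      refine pow_le_pow_left₀ (by positivity) ?_ _
      have : ‖k‖ ≤ ‖k - m‖ + ‖m‖ := by simpa using norm_add_le (k - m) m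
      nlinarith [norm_nonneg m, norm_nonneg (k - m)]
    calc (1 + ‖k‖) ^ M * (‖UnitAddTorus.mFourier k ξ.1‖ * _)
        ≤ (1 + ‖k‖) ^ M * (1 * ∑ j ∈ Finset.range (i + 1), (i.choose j : ℝ) *
            ‖iteratedFDeriv ℝ j (lift fun y => UnitAddTorus.mFourier ξ.2 y) x‖ *
            ‖iteratedFDeriv ℝ (i - j) (fun x => lift (fun y => Φ (k - m, y)) (x - b)) x‖) := by
          gcongr
      _ = ∑ j ∈ Finset.range (i + 1), (i.choose j : ℝ) *
            ‖iteratedFDeriv ℝ j (lift fun y => UnitAddTorus.mFourier ξ.2 y) x‖ *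
            ((1 + ‖k‖) ^ M * ‖iteratedFDeriv ℝ (i - j)
              (fun x => lift (fun y => Φ (k - m, y)) (x - b)) x‖) := by
          rw [one_mul, Finset.mul_sum]
          exact Finset.sum_congr rfl fun j _ => by ring
      _ ≤ _ := by
          refine Finset.sum_le_sum fun j _ => ?_
          have hj : (1 + ‖k‖) ^ M * ‖iteratedFDeriv ℝ (i - j)
              (fun x => lift (fun y => Φ (k - m, y)) (x - b)) x‖ ≤ (1 + ‖m‖) ^ M * D (i - j) := by
            rw [iteratedFDeriv_comp_sub]
            refine (mul_le_mul_of_nonneg_right hk (norm_nonneg _)).trans ?_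
            rw [mul_assoc]
            exact mul_le_mul_of_nonneg_left (hD (i - j) (k - m) (x - b)) (by positivity)
          refine mul_le_mul ?_ hj (by positivity) (mul_nonneg (by positivity) (hA0 j))
          exact mul_le_mul_of_nonneg_left (hA j x) (by positivity)

theorem IsSchwartzZT.conj {n : ℕ} {Φ : Zn n × Tn n → ℂ} (h : IsSchwartzZT Φ) :
    IsSchwartzZT fun q => conj (Φ q) := by
  obtain ⟨h1, h2⟩ := h
  have e : ∀ k, (lift fun y => conj (Φ (k, y))) =
      Complex.conjLIE ∘ (lift fun y => Φ (k, y)) := fun k => rfl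
  refine ⟨fun k => ?_, fun M i => ?_⟩
  · rw [e]; exact Complex.conjLIE.contDiff.comp (h1 k)
  · obtain ⟨C, hC⟩ := h2 M i
    refine ⟨C, fun k x => ?_⟩
    rw [e, LinearIsometryEquiv.norm_iteratedFDeriv_comp_left]
    exact hC k x

/-- The test function `conj (M_ξ T_z Φ)`. -/
def conjShift {n : ℕ} (Φ : schwartzZT n) (z : Zn n × Tn n) (ξ : Tn n × Zn n) : schwartzZT n :=
  ⟨fun q => conj (tfShiftZT z ξ Φ.1 q), (IsSchwartzZT.tfShift Φ.2 z ξ).conj⟩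

/-- The short-time Fourier transform `V_Φ σ (z, ξ) = ⟨σ, M_ξ T_z Φ⟩` of a tempered distribution on
`ℤⁿ × 𝕋ⁿ`; the sesquilinear pairing is `⟨σ, Ψ⟩ = σ (conj Ψ)`. -/
def stftZT {n : ℕ} (Φ : schwartzZT n) (σ : temperedZT n)
    (a : (Zn n × Tn n) × (Tn n × Zn n)) : ℂ :=
  σ.1 (conjShift Φ a.1 a.2)

/-- The modulation space `M^p(ℤⁿ × 𝕋ⁿ)` (with window `Φ`). -/
def modZT {n : ℕ} (Φ : schwartzZT n) (p : ℝ≥0∞) : Submodule ℂ (temperedZT n) where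
  carrier := {σ | MemLp (stftZT Φ σ) p (doublePhaseMeasure n)}
  zero_mem' := MemLp.zero (p := p) (μ := doublePhaseMeasure n)
  add_mem' := fun h h' => MemLp.add h h'
  smul_mem' := fun c _ h => MemLp.const_smul h c

/-- The norm of `M^p(ℤⁿ × 𝕋ⁿ)` (with window `Φ`). -/
def modNormZT {n : ℕ} (Φ : schwartzZT n) (p : ℝ≥0∞) (σ : temperedZT n) : ℝ :=
  (eLpNorm (stftZT Φ σ) p (doublePhaseMeasure n)).toReal

/-- The distribution `σ` is given by the function `s`. -/
def IsGivenBy {n : ℕ} (σ : temperedZT n) (s : Zn n × Tn n → ℂ) : Prop :=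
  ∀ Φ : schwartzZT n, σ.1 Φ = ∑' m, ∫ w, s (m, w) * Φ.1 (m, w) ∂torusMeasure n

/-! Localization operators. -/

/-- The Hilbert space `ℓ²(ℤⁿ)`. -/
abbrev ell2 (n : ℕ) := lp (fun _ : Zn n => ℂ) 2

/-- The localization operator with windows `g₁, g₂` and symbol `s`,
`f ↦ ∑ₘ ∫ s(m, w) V_{g₁} f(m, w) M_w T_m g₂ dw`, for `s` in `L¹ ∪ L^∞`. -/
def locOp {n : ℕ} (g₁ g₂ : Zn n → ℂ) (s : Zn n × Tn n → ℂ) (f : ell2 n) (k : Zn n) : ℂ :=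
  ∑' m, ∫ w, s (m, w) * stft g₁ f (m, w) * tfShift (m, w) g₂ k ∂torusMeasure n

/-- The linear map `𝓛` from `M^p(ℤⁿ × 𝕋ⁿ)` to the bounded operators on `ℓ²(ℤⁿ)` sends every symbol
in `S` that is a function in `L¹ ∪ L^∞` to its localization operator. -/
def ExtendsLocOp {n : ℕ} {Φ : schwartzZT n} {p : ℝ≥0∞} (g₁ g₂ : Zn n → ℂ)
    (𝓛 : modZT Φ p →ₗ[ℂ] (ell2 n →L[ℂ] ell2 n)) (S : Set (temperedZT n)) : Prop :=
  ∀ (σ : modZT Φ p) (s : Zn n × Tn n → ℂ), σ.1 ∈ S →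
    (MemLp s 1 (phaseMeasure n) ∨ MemLp s ⊤ (phaseMeasure n)) → IsGivenBy σ.1 s →
    ∀ (f : ell2 n) (k : Zn n), 𝓛 σ f k = locOp g₁ g₂ s f k

/-- `𝓛` is bounded from `M^p(ℤⁿ × 𝕋ⁿ)` to the bounded operators on `ℓ²(ℤⁿ)`. -/
def IsBoundedOnMod {n : ℕ} {Φ : schwartzZT n} {p : ℝ≥0∞}
    (𝓛 : modZT Φ p →ₗ[ℂ] (ell2 n →L[ℂ] ell2 n)) : Prop :=
  ∃ K : ℝ, ∀ σ : modZT Φ p, ‖𝓛 σ‖ ≤ K * modNormZT Φ p σ.1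

/-- With respect to the windows `φ` of `M¹(ℤⁿ)` and `Φ` of `M^p(ℤⁿ × 𝕋ⁿ)`, the operators
`L_σ^{g₁,g₂}` extend uniquely to all `σ ∈ M^p(ℤⁿ × 𝕋ⁿ)`, with the norm estimate with constant `C`.
The extension agrees with the defining formula for every symbol in `M^p ∩ (L¹ ∪ L^∞)`, and is
determined already by the symbols in `M¹ ∩ M^∞`. -/
def UniqueBoundedExtension {n : ℕ} (φ : Zn n → ℂ) (Φ : schwartzZT n) (C : ℝ) (p : ℝ≥0∞)
    (g₁ g₂ : Zn n → ℂ) : Prop :=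
  ∃ 𝓛 : modZT Φ p →ₗ[ℂ] (ell2 n →L[ℂ] ell2 n),
    ExtendsLocOp g₁ g₂ 𝓛 Set.univ ∧
    (∀ σ : modZT Φ p,
      ‖𝓛 σ‖ ≤ C * modNormZT Φ p σ.1 * modNorm φ 1 g₁ * modNorm φ 1 g₂) ∧
    ∀ 𝓛' : modZT Φ p →ₗ[ℂ] (ell2 n →L[ℂ] ell2 n), IsBoundedOnMod 𝓛' →
      ExtendsLocOp g₁ g₂ 𝓛' {σ | σ ∈ modZT Φ 1 ∧ σ ∈ modZT Φ ⊤} → 𝓛' = 𝓛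

end LocOp

end

noncomputable section

namespace LocOp

instance (n : ℕ) : IsProbabilityMeasure (torusMeasure n) :=
  inferInstanceAs (IsProbabilityMeasure (Measure.pi _))

instance (n : ℕ) : (torusMeasure n).IsAddLeftInvariant :=
  inferInstanceAs (Measure.IsAddLeftInvariant (Measure.pi _))

instance (n : ℕ) : SFinite (phaseMeasure n) :=
  inferInstanceAs (SFinite (Measure.prod _ _))

instance (n : ℕ) : SFinite (doublePhaseMeasure n) :=
  inferInstanceAs (SFinite (Measure.prod _ _))

/-! Summation over the lattice. -/

theorem summable_int_weight : Summable fun t : ℤ => ((1 + |(t : ℝ)|) ^ 2)⁻¹ := by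
  have h : Summable fun k : ℕ => ((1 + (k : ℝ)) ^ 2)⁻¹ := by
    have := (summable_nat_add_iff 1).2 (Real.summable_nat_pow_inv (p := 2) |>.2 (by norm_num))
    refine this.congr fun k => ?_
    push_cast
    rw [add_comm]
  refine Summable.of_nat_of_neg ?_ ?_ <;> simpa using h

theorem summable_prod_weight (n : ℕ) :
    Summable fun k : Zn n => ∏ i, ((1 + |(k i : ℝ)|) ^ 2)⁻¹ := by
  induction n with
  | zero => exact Summable.of_finite
  | succ n ih =>
    have h := summable_int_weight.mul_of_nonneg ih (fun _ => by positivity)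
      (fun _ => by positivity)
    rw [← (Fin.consEquiv fun _ : Fin (n + 1) => ℤ).summable_iff]
    refine h.congr fun x => ?_
    simp [Fin.prod_univ_succ, Fin.consEquiv, mul_comm]

theorem summable_weight (n : ℕ) : Summable fun k : Zn n => ((1 + ‖k‖) ^ (2 * n))⁻¹ := by
  refine (summable_prod_weight n).of_nonneg_of_le (fun _ => by positivity) fun k => ?_
  rw [Finset.prod_inv_distrib]
  refine inv_anti₀ (Finset.prod_pos fun _ _ => by positivity) ?_
  calc ∏ i, (1 + |(k i : ℝ)|) ^ 2 ≤ ∏ _i : Fin n, (1 + ‖k‖) ^ 2 := by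
        refine Finset.prod_le_prod (fun _ _ => by positivity) fun i _ => ?_
        have : |(k i : ℝ)| ≤ ‖k‖ := by simpa [Int.norm_eq_abs] using norm_le_pi_norm k i
        gcongr
    _ = (1 + ‖k‖) ^ (2 * n) := by simp [pow_mul]

/-! Characters of the torus. -/

theorem norm_mFourier_apply {n : ℕ} (j : Zn n) (y : Tn n) : ‖UnitAddTorus.mFourier j y‖ = 1 := by
  simp only [UnitAddTorus.mFourier, fourier_apply, ContinuousMap.coe_mk, norm_prod]
  exact Finset.prod_eq_one fun _ _ => Circle.norm_coe _

theorem conj_mFourier {n : ℕ} (j : Zn n) (y : Tn n) :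
    conj (UnitAddTorus.mFourier j y) = UnitAddTorus.mFourier (-j) y :=
  UnitAddTorus.mFourier_neg.symm

theorem mFourier_apply_add {n : ℕ} (j : Zn n) (y z : Tn n) :
    UnitAddTorus.mFourier j (y + z) = UnitAddTorus.mFourier j y * UnitAddTorus.mFourier j z := by
  simp [UnitAddTorus.mFourier, fourier_apply, AddCircle.toCircle_add, ← Finset.prod_mul_distrib]

/-- The point of the torus represented by `x`. -/
def toTorus {n : ℕ} (x : Fin n → ℝ) : Tn n := fun i => (x i : UnitAddCircle)

theorem toTorus_add {n : ℕ} (x y : Fin n → ℝ) : toTorus (x + y) = toTorus x + toTorus y := by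
  funext i
  simp [toTorus]

theorem isOpenQuotientMap_toTorus (n : ℕ) : IsOpenQuotientMap (toTorus (n := n)) :=
  IsOpenQuotientMap.piMap fun _ => QuotientAddGroup.isOpenQuotientMap_mk

theorem mFourier_toTorus {n : ℕ} (j : Zn n) (x : Fin n → ℝ) :
    UnitAddTorus.mFourier j (toTorus x) =
      Complex.exp (2 * Real.pi * Complex.I * (dotForm j x : ℝ)) :=
  congrFun (lift_mFourier j) x

theorem dotForm_single {n : ℕ} (j : Zn n) (i : Fin n) (t : ℝ) :
    dotForm j (Pi.single i t) = j i * t := by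
  simp [dotForm, Pi.single_apply]

theorem integral_mFourier {n : ℕ} {j : Zn n} (hj : j ≠ 0) :
    ∫ y, UnitAddTorus.mFourier j y ∂torusMeasure n = 0 := by
  obtain ⟨i, hi⟩ := Function.ne_iff.1 hj
  have hi' : (j i : ℝ) ≠ 0 := by exact_mod_cast hi
  set v : Tn n := toTorus (Pi.single i (1 / (2 * (j i : ℝ)))) with hv
  have hc : UnitAddTorus.mFourier j v = -1 := by
    rw [hv, mFourier_toTorus, dotForm_single, ← Complex.exp_pi_mul_I]
    congr 1
    have : (j i : ℝ) * (1 / (2 * (j i : ℝ))) = 1 / 2 := by field_simp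
    rw [this]
    push_cast
    ring
  have h := integral_add_left_eq_self (μ := torusMeasure n)
    (fun y => UnitAddTorus.mFourier j y) v
  simp only [mFourier_apply_add, hc, integral_const_mul] at h
  have h2 : (2 : ℂ) * ∫ y, UnitAddTorus.mFourier j y ∂torusMeasure n = 0 := by
    linear_combination -h
  simpa using h2

theorem integral_mFourier_zero (n : ℕ) :
    ∫ y, UnitAddTorus.mFourier (0 : Zn n) y ∂torusMeasure n = 1 := by
  simp [UnitAddTorus.mFourier_zero]

theorem integrable_torus {n : ℕ} {f : Tn n → ℂ} (hf : Continuous f) :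
    Integrable f (torusMeasure n) := by
  refine hf.integrable_of_hasCompactSupport ?_
  exact HasCompactSupport.of_compactSpace f

/-- The coefficients of an absolutely convergent series in an orthonormal system of unimodular
functions are bounded by the `L¹` norm of its sum. -/
theorem enorm_coeff_le_lintegral {X ι : Type*} [MeasurableSpace X] {μ : Measure X}
    [IsProbabilityMeasure μ] [Countable ι] {χ : ι → X → ℂ} (hm : ∀ l, AEStronglyMeasurable (χ l) μ)
    (h1 : ∀ l x, ‖χ l x‖ = 1) (i : ι) (ho : ∀ l, l ≠ i → ∫ x, χ l x * conj (χ i x) ∂μ = 0)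
    {c : ι → ℂ} (hc : Summable c) :
    ‖c i‖ₑ ≤ ∫⁻ x, ‖∑' l, c l * χ l x‖ₑ ∂μ := by
  have hn : ∀ l x, ‖c l * χ l x * conj (χ i x)‖ = ‖c l‖ := fun l x => by simp [h1]
  have hint : ∀ l, Integrable (fun x => c l * χ l x * conj (χ i x)) μ := fun l => by
    refine Integrable.of_bound (((hm l).const_mul (c l)).mul
      (Complex.continuous_conj.comp_aestronglyMeasurable (hm i))) ‖c l‖ ?_
    exact Filter.Eventually.of_forall fun x => (hn l x).le
  have hs := hasSum_integral_of_summable_integral_norm hint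
    (by simp only [hn, integral_const, probReal_univ, one_smul]; exact hc.norm)
  have hi : ∑' l, ∫ x, c l * χ l x * conj (χ i x) ∂μ = c i := by
    rw [tsum_eq_single i]
    · have : ∀ x, c i * χ i x * conj (χ i x) = c i := fun x => by
        rw [mul_assoc, Complex.mul_conj, Complex.normSq_eq_norm_sq, h1]; simp
      simp [this]
    · intro l hl
      simp_rw [mul_assoc]
      rw [integral_const_mul, ho l hl, mul_zero]
  rw [← hi, hs.tsum_eq]
  refine (enorm_integral_le_lintegral_enorm _).trans (lintegral_mono fun x => ?_)
  have hx : ∑' l, c l * χ l x * conj (χ i x) = (∑' l, c l * χ l x) * conj (χ i x) := tsum_mul_right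
  have h2 : ‖conj (χ i x)‖ₑ = 1 := by rw [← ofReal_norm]; simp [h1]
  rw [hx, enorm_mul, h2, mul_one]

/-- The Fourier coefficient in the torus variable, `∫ Ψ(k, y) e^{-2πi j·y} dy`. -/
def fc {n : ℕ} (Ψ : Zn n × Tn n → ℂ) (q : Zn n × Zn n) : ℂ :=
  ∫ y, UnitAddTorus.mFourier (-q.2) y * Ψ (q.1, y) ∂torusMeasure n

theorem lift_apply {n : ℕ} (u : Tn n → ℂ) (x : Fin n → ℝ) : lift u x = u (toTorus x) := rfl

theorem continuous_schwartz {n : ℕ} (Ψ : schwartzZT n) (k : Zn n) :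
    Continuous fun y => Ψ.1 (k, y) :=
  (isOpenQuotientMap_toTorus n).isQuotientMap.continuous_iff.2 (Ψ.2.1 k).continuous

theorem exists_norm_schwartz_le {n : ℕ} (Ψ : schwartzZT n) (M : ℕ) :
    ∃ C : ℝ, 0 ≤ C ∧ ∀ k y, (1 + ‖k‖) ^ M * ‖Ψ.1 (k, y)‖ ≤ C := by
  obtain ⟨C, hC⟩ := Ψ.2.2 M 0
  refine ⟨max C 0, le_max_right _ _, fun k y => ?_⟩
  obtain ⟨x, rfl⟩ := (isOpenQuotientMap_toTorus n).surjective y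
  refine le_trans ?_ (le_max_left C 0)
  simpa [lift_apply] using hC k x

theorem continuous_fc_integrand {n : ℕ} (Ψ : schwartzZT n) (q : Zn n × Zn n) :
    Continuous fun y => UnitAddTorus.mFourier (-q.2) y * Ψ.1 (q.1, y) :=
  (UnitAddTorus.mFourier (-q.2)).continuous.mul (continuous_schwartz Ψ q.1)

theorem fc_add {n : ℕ} (Ψ Θ : schwartzZT n) (q : Zn n × Zn n) :
    fc (Ψ + Θ : schwartzZT n).1 q = fc Ψ.1 q + fc Θ.1 q := by
  simp only [fc]
  rw [← integral_add (integrable_torus (continuous_fc_integrand Ψ q))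
    (integrable_torus (continuous_fc_integrand Θ q))]
  refine integral_congr_ae (Filter.Eventually.of_forall fun y => ?_)
  simp [mul_add]

theorem fc_smul {n : ℕ} (c : ℂ) (Ψ : schwartzZT n) (q : Zn n × Zn n) :
    fc (c • Ψ : schwartzZT n).1 q = c * fc Ψ.1 q := by
  simp only [fc]
  rw [← integral_const_mul]
  refine integral_congr_ae (Filter.Eventually.of_forall fun y => ?_)
  simp [mul_left_comm]

theorem norm_fc_le {n : ℕ} {Ψ : schwartzZT n} {B : ℝ} (q : Zn n × Zn n)
    (h : ∀ y, ‖Ψ.1 (q.1, y)‖ ≤ B) : ‖fc Ψ.1 q‖ ≤ B := by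
  have := norm_integral_le_of_norm_le_const (μ := torusMeasure n) (C := B)
    (f := fun y => UnitAddTorus.mFourier (-q.2) y * Ψ.1 (q.1, y))
    (Filter.Eventually.of_forall fun y => by simpa [norm_mFourier_apply] using h y)
  simpa [fc] using this

/-! Differentiation on the torus. -/

theorem lift_add_int {n : ℕ} (u : Tn n → ℂ) {v : Fin n → ℝ} (hv : toTorus v = 0) :
    (fun x => lift u (x + v)) = lift u := by
  funext x
  simp [lift_apply, toTorus_add, hv]

theorem exists_partial {n : ℕ} (Ψ : schwartzZT n) (i : Fin n) :
    ∃ Θ : schwartzZT n, ∀ k x, Θ.1 (k, toTorus x) =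
      fderiv ℝ (lift fun y => Ψ.1 (k, y)) x (Pi.single i 1) := by
  set r : Tn n → (Fin n → ℝ) := Function.surjInv (isOpenQuotientMap_toTorus n).surjective
  have hr : ∀ y, toTorus (r y) = y := Function.surjInv_eq _
  set Θ : Zn n × Tn n → ℂ := fun q =>
    fderiv ℝ (lift fun y => Ψ.1 (q.1, y)) (r q.2) (Pi.single i 1) with hΘ
  have key : ∀ k x, Θ (k, toTorus x) = fderiv ℝ (lift fun y => Ψ.1 (k, y)) x (Pi.single i 1) := by
    intro k x
    have hv : toTorus (r (toTorus x) - x) = 0 := by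
      have := toTorus_add (r (toTorus x) - x) x
      rw [sub_add_cancel, hr] at this
      simpa using this
    have h := congrArg (fun f => fderiv ℝ f x) (lift_add_int (fun y => Ψ.1 (k, y)) hv)
    simp only [fderiv_comp_add_right, add_sub_cancel] at h
    simp [hΘ, h]
  have e : ∀ k, (lift fun y => Θ (k, y)) =
      fun x => fderiv ℝ (lift fun y => Ψ.1 (k, y)) x (Pi.single i 1) := fun k => by
    funext x
    exact key k x
  have hd : ∀ k, ContDiff ℝ ∞ (fderiv ℝ (lift fun y => Ψ.1 (k, y))) := fun k =>
    (Ψ.2.1 k).fderiv_right (by simp)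
  refine ⟨⟨Θ, fun k => ?_, fun M l => ?_⟩, key⟩
  · rw [e]
    exact (hd k).clm_apply contDiff_const
  · obtain ⟨C, hC⟩ := Ψ.2.2 M (l + 1)
    refine ⟨‖(Pi.single i 1 : Fin n → ℝ)‖ * C, fun k x => ?_⟩
    rw [e]
    have h1 := norm_iteratedFDeriv_clm_apply_const (c := (Pi.single i 1 : Fin n → ℝ)) (n := l)
      ((hd k).contDiffAt (x := x)) (by exact_mod_cast le_top)
    rw [norm_iteratedFDeriv_fderiv] at h1
    calc _ ≤ (1 + ‖k‖) ^ M * (‖(Pi.single i 1 : Fin n → ℝ)‖ *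
          ‖iteratedFDeriv ℝ (l + 1) (lift fun y => Ψ.1 (k, y)) x‖) := by gcongr
      _ = ‖(Pi.single i 1 : Fin n → ℝ)‖ * ((1 + ‖k‖) ^ M *
          ‖iteratedFDeriv ℝ (l + 1) (lift fun y => Ψ.1 (k, y)) x‖) := by ring
      _ ≤ _ := by gcongr; exact hC k x

/-- The partial derivative of a Schwartz function in the `i`-th torus variable. -/
def partialZT {n : ℕ} (i : Fin n) (Ψ : schwartzZT n) : schwartzZT n :=
  (exists_partial Ψ i).choose

theorem partialZT_apply {n : ℕ} (i : Fin n) (Ψ : schwartzZT n) (k : Zn n) (x : Fin n → ℝ) :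
    (partialZT i Ψ).1 (k, toTorus x) =
      fderiv ℝ (lift fun y => Ψ.1 (k, y)) x (Pi.single i 1) :=
  (exists_partial Ψ i).choose_spec k x

theorem hasDerivAt_translate {n : ℕ} (i : Fin n) (Ψ : schwartzZT n) (k : Zn n) (y : Tn n) (t : ℝ) :
    HasDerivAt (fun t : ℝ => Ψ.1 (k, y + toTorus (Pi.single i t)))
      ((partialZT i Ψ).1 (k, y + toTorus (Pi.single i t))) t := by
  obtain ⟨x, rfl⟩ := (isOpenQuotientMap_toTorus n).surjective y
  have hline : HasDerivAt (fun t : ℝ => x + Pi.single i t) (Pi.single i (1 : ℝ)) t := by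
    have he : (fun t : ℝ => x + Pi.single i t) = fun t => x + t • Pi.single i (1 : ℝ) := by
      funext s
      rw [← Pi.single_smul, smul_eq_mul, mul_one]
    rw [he]
    simpa using ((hasDerivAt_id t).smul_const (Pi.single i (1 : ℝ) : Fin n → ℝ)).const_add x
  have hf : HasFDerivAt (lift fun y => Ψ.1 (k, y))
      (fderiv ℝ (lift fun y => Ψ.1 (k, y)) (x + Pi.single i t)) (x + Pi.single i t) :=
    (((Ψ.2.1 k).differentiable (by simp)) _).hasFDerivAt
  have h := hf.comp_hasDerivAt t hline
  rw [← partialZT_apply, toTorus_add] at h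
  refine h.congr_of_eventuallyEq (Filter.Eventually.of_forall fun s => ?_)
  simp [lift_apply, toTorus_add]

theorem fc_partialZT {n : ℕ} (i : Fin n) (Ψ : schwartzZT n) (q : Zn n × Zn n) :
    fc (partialZT i Ψ).1 q = 2 * Real.pi * Complex.I * q.2 i * fc Ψ.1 q := by
  obtain ⟨k, j⟩ := q
  obtain ⟨C, -, hC⟩ := exists_norm_schwartz_le (partialZT i Ψ) 0
  have hcont : ∀ (Θ : schwartzZT n) (t : ℝ), Continuous fun y =>
      UnitAddTorus.mFourier (-j) y * Θ.1 (k, y + toTorus (Pi.single i t)) := fun Θ t =>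
    (UnitAddTorus.mFourier (-j)).continuous.mul
      ((continuous_schwartz Θ k).comp (continuous_id.add continuous_const))
  have hL : HasDerivAt (fun t : ℝ => ∫ y, UnitAddTorus.mFourier (-j) y *
      Ψ.1 (k, y + toTorus (Pi.single i t)) ∂torusMeasure n)
      (∫ y, UnitAddTorus.mFourier (-j) y *
      (partialZT i Ψ).1 (k, y + toTorus (Pi.single i 0)) ∂torusMeasure n) 0 := by
    refine (hasDerivAt_integral_of_dominated_loc_of_deriv_le (bound := fun _ => C)
      (Filter.univ_mem) (Filter.Eventually.of_forall fun t => (hcont Ψ t).aestronglyMeasurable)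
      (integrable_torus (hcont Ψ 0)) (hcont (partialZT i Ψ) 0).aestronglyMeasurable
      (Filter.Eventually.of_forall fun y t _ => ?_) (integrable_const C)
      (F' := fun t y => UnitAddTorus.mFourier (-j) y *
        (partialZT i Ψ).1 (k, y + toTorus (Pi.single i t)))
      (Filter.Eventually.of_forall fun y t _ => ?_)).2
    · simpa [norm_mFourier_apply] using hC k (y + toTorus (Pi.single i t))
    · exact (hasDerivAt_translate i Ψ k y t).const_mul _
  have hR : ∀ t : ℝ, ∫ y, UnitAddTorus.mFourier (-j) y *
      Ψ.1 (k, y + toTorus (Pi.single i t)) ∂torusMeasure n =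
      fc Ψ.1 (k, j) * Complex.exp (2 * Real.pi * Complex.I * j i * t) := by
    intro t
    set v : Tn n := toTorus (Pi.single i t) with hv
    have hexp : Complex.exp (2 * Real.pi * Complex.I * j i * t) = UnitAddTorus.mFourier j v := by
      rw [hv, mFourier_toTorus, dotForm_single]
      push_cast
      ring_nf
    have hone : UnitAddTorus.mFourier (-j) v * UnitAddTorus.mFourier j v = 1 := by
      rw [← UnitAddTorus.mFourier_add]
      simp [UnitAddTorus.mFourier_zero]
    have h := integral_add_right_eq_self (μ := torusMeasure n)
      (fun y => UnitAddTorus.mFourier (-j) y * Ψ.1 (k, y)) v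
    rw [hexp, fc, ← h, ← integral_mul_const]
    refine integral_congr_ae (Filter.Eventually.of_forall fun y => ?_)
    simp only [mFourier_apply_add]
    linear_combination (-UnitAddTorus.mFourier (-j) y * Ψ.1 (k, y + v)) * hone
  have hR' : HasDerivAt (fun t : ℝ =>
      fc Ψ.1 (k, j) * Complex.exp (2 * Real.pi * Complex.I * j i * t))
      (fc Ψ.1 (k, j) * (2 * Real.pi * Complex.I * j i)) 0 := by
    have h1 : HasDerivAt (fun t : ℝ => Complex.exp (2 * Real.pi * Complex.I * j i * t))
      (Complex.exp (2 * Real.pi * Complex.I * j i * (0 : ℝ)) *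
        (2 * Real.pi * Complex.I * j i * 1)) 0 :=
      ((Complex.ofRealCLM.hasDerivAt (x := 0)).const_mul _).cexp
    simpa using h1.const_mul (fc Ψ.1 (k, j))
  simp only [hR] at hL
  have h := hL.unique hR'
  have h0 : toTorus (Pi.single i (0 : ℝ)) = 0 := by
    funext l
    simp [toTorus]
  simp only [h0, add_zero] at h
  rw [fc]
  simp only [h]
  ring

/-- The Fourier coefficients of a Schwartz function are rapidly decreasing. -/
theorem exists_norm_fc_le {n : ℕ} (M N : ℕ) (Ψ : schwartzZT n) :
    ∃ C : ℝ, 0 ≤ C ∧ ∀ q, (1 + ‖q.1‖) ^ M * (1 + ‖q.2‖) ^ N * ‖fc Ψ.1 q‖ ≤ C := by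
  induction N generalizing Ψ with
  | zero =>
    obtain ⟨C, hC, h⟩ := exists_norm_schwartz_le Ψ M
    refine ⟨C, hC, fun q => ?_⟩
    have h1 : ‖fc Ψ.1 q‖ ≤ C / (1 + ‖q.1‖) ^ M := norm_fc_le q fun y => by
      rw [le_div_iff₀' (by positivity)]
      exact h q.1 y
    rw [le_div_iff₀' (by positivity)] at h1
    simpa using h1
  | succ N ih =>
    obtain ⟨C, hC, h⟩ := ih Ψ
    choose D hD hd using fun i => ih (partialZT i Ψ)
    refine ⟨C + ∑ i, D i, by have := Finset.sum_nonneg fun i (_ : i ∈ Finset.univ) => hD i; positivity,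
      fun q => ?_⟩
    have hj : ‖q.2‖ * ‖fc Ψ.1 q‖ ≤ ∑ i, ‖fc (partialZT i Ψ).1 q‖ := by
      have hi : ∀ i, ‖q.2 i‖ * ‖fc Ψ.1 q‖ ≤ ‖fc (partialZT i Ψ).1 q‖ := fun i => by
        rw [fc_partialZT]
        have : ‖q.2 i‖ ≤ ‖(2 * Real.pi * Complex.I * (q.2 i : ℂ) : ℂ)‖ := by
          simp only [norm_mul, Complex.norm_I, mul_one, Complex.norm_intCast, Int.norm_eq_abs,
            Complex.norm_real, Complex.norm_ofNat, Real.norm_eq_abs, abs_of_pos Real.pi_pos]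
          nlinarith [Real.pi_gt_three, abs_nonneg (q.2 i : ℝ)]
        rw [norm_mul]
        gcongr
      have hq : ‖q.2‖ ≤ ∑ i, ‖q.2 i‖ :=
        (pi_norm_le_iff_of_nonneg (by positivity)).2 fun i =>
          Finset.single_le_sum (f := fun i => ‖q.2 i‖) (fun _ _ => norm_nonneg _)
            (Finset.mem_univ i)
      calc _ ≤ (∑ i, ‖q.2 i‖) * ‖fc Ψ.1 q‖ := by gcongr
        _ ≤ _ := by rw [Finset.sum_mul]; exact Finset.sum_le_sum fun i _ => hi i
    calc (1 + ‖q.1‖) ^ M * (1 + ‖q.2‖) ^ (N + 1) * ‖fc Ψ.1 q‖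
        = (1 + ‖q.1‖) ^ M * (1 + ‖q.2‖) ^ N * ‖fc Ψ.1 q‖ +
          (1 + ‖q.1‖) ^ M * (1 + ‖q.2‖) ^ N * (‖q.2‖ * ‖fc Ψ.1 q‖) := by ring
      _ ≤ C + (1 + ‖q.1‖) ^ M * (1 + ‖q.2‖) ^ N * ∑ i, ‖fc (partialZT i Ψ).1 q‖ := by
          gcongr
          exact h q
      _ ≤ C + ∑ i, D i := by
          rw [Finset.mul_sum]
          gcongr with i
          exact hd i q

theorem summable_fc_weight {n : ℕ} (M N : ℕ) (Ψ : schwartzZT n) :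
    Summable fun q : Zn n × Zn n => (1 + ‖q.1‖) ^ M * (1 + ‖q.2‖) ^ N * ‖fc Ψ.1 q‖ := by
  obtain ⟨C, hC, h⟩ := exists_norm_fc_le (M + 2 * n) (N + 2 * n) Ψ
  refine ((summable_weight n).mul_of_nonneg (summable_weight n) (fun _ => by positivity)
    (fun _ => by positivity) |>.mul_left C).of_nonneg_of_le (fun _ => by positivity) fun q => ?_
  rw [← mul_inv, ← div_eq_mul_inv, le_div_iff₀ (by positivity)]
  refine le_trans (le_of_eq ?_) (h q)
  ring

theorem summable_norm_fc {n : ℕ} (Ψ : schwartzZT n) : Summable fun q => ‖fc Ψ.1 q‖ := by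
  simpa using summable_fc_weight 0 0 Ψ

/-- Fourier inversion on the torus. -/
theorem hasSum_fc {n : ℕ} (Ψ : schwartzZT n) (k : Zn n) (y : Tn n) :
    HasSum (fun j => fc Ψ.1 (k, j) * UnitAddTorus.mFourier j y) (Ψ.1 (k, y)) := by
  have hs : Summable fun j => fc Ψ.1 (k, j) :=
    ((summable_norm_fc Ψ).comp_injective (i := fun j => (k, j))
      (fun _ _ h => (Prod.ext_iff.1 h).2)).of_norm
  exact UnitAddTorus.hasSum_mFourier_series_apply_of_summable
    (f := ⟨fun y => Ψ.1 (k, y), continuous_schwartz Ψ k⟩) hs y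

theorem exists_fc_ne_zero {n : ℕ} {Ψ : schwartzZT n} (h : Ψ ≠ 0) : ∃ q, fc Ψ.1 q ≠ 0 := by
  by_contra! h0
  refine h (Subtype.ext (funext fun q => ?_))
  have := hasSum_fc Ψ q.1 q.2
  simp only [h0, zero_mul] at this
  exact this.unique hasSum_zero

theorem norm_dotForm_le {n : ℕ} (j : Zn n) : ‖dotForm j‖ ≤ n * ‖j‖ := by
  refine ContinuousLinearMap.opNorm_le_bound _ (by positivity) fun x => ?_
  have hd : dotForm j x = ∑ i, (j i : ℝ) * x i := by simp [dotForm]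
  rw [hd]
  calc ‖∑ i, (j i : ℝ) * x i‖ ≤ ∑ _i : Fin n, ‖j‖ * ‖x‖ := by
        refine (norm_sum_le _ _).trans (Finset.sum_le_sum fun i _ => ?_)
        rw [norm_mul]
        have : ‖(j i : ℝ)‖ ≤ ‖j‖ := by simpa [Int.norm_eq_abs] using norm_le_pi_norm j i
        gcongr
        exact norm_le_pi_norm x i
    _ = n * ‖j‖ * ‖x‖ := by simp [mul_assoc]

theorem norm_iteratedFDeriv_lift_mFourier_le {n : ℕ} (j : Zn n) (i : ℕ) (x : Fin n → ℝ) :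
    ‖iteratedFDeriv ℝ i (lift (fun y => UnitAddTorus.mFourier j y)) x‖ ≤
      (2 * Real.pi * (n + 1) * (1 + ‖j‖)) ^ i := by
  rw [lift_mFourier, (dotForm j).iteratedFDeriv_comp_right (contDiff_exp_char _) x (i := i)
    (by exact_mod_cast le_top)]
  refine (ContinuousMultilinearMap.norm_compContinuousLinearMap_le _ _).trans ?_
  rw [norm_iteratedFDeriv_eq_norm_iteratedDeriv, iteratedDeriv_exp_char, norm_mul, norm_pow,
    Complex.norm_exp, Finset.prod_const, Finset.card_univ, Fintype.card_fin]
  have h1 : ‖(2 * Real.pi * Complex.I : ℂ)‖ = 2 * Real.pi := by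
    simp [abs_of_pos Real.pi_pos]
  have h2 : ‖dotForm j‖ ≤ (n + 1) * (1 + ‖j‖) := by
    refine (norm_dotForm_le j).trans ?_
    gcongr <;> linarith
  rw [h1]
  have h3 : ((2 * Real.pi * Complex.I : ℂ) * ((dotForm j x : ℝ) : ℂ)).re = 0 := by simp
  rw [h3, Real.exp_zero, mul_one, ← mul_pow]
  refine pow_le_pow_left₀ (by positivity) ?_ _
  rw [mul_assoc (2 * Real.pi)]
  gcongr

/-- The function `δ_k ⊗ e_j` on `ℤⁿ × 𝕋ⁿ`, for `q = (k, j)`. -/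
def basisFn {n : ℕ} (q : Zn n × Zn n) : schwartzZT n :=
  ⟨fun p => if p.1 = q.1 then UnitAddTorus.mFourier q.2 p.2 else 0, by
    have e : ∀ k, (lift fun y => if k = q.1 then UnitAddTorus.mFourier q.2 y else (0 : ℂ)) =
        (if k = q.1 then (1 : ℂ) else 0) • lift fun y => UnitAddTorus.mFourier q.2 y := by
      intro k
      funext x
      by_cases h : k = q.1 <;> simp [lift, h]
    have hs := contDiff_lift_mFourier q.2
    refine ⟨fun k => ?_, fun M i => ?_⟩
    · simp only [e]
      exact hs.const_smul (if k = q.1 then (1 : ℂ) else 0)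
    · refine ⟨(1 + ‖q.1‖) ^ M * (2 * Real.pi * (n + 1) * (1 + ‖q.2‖)) ^ i, fun k x => ?_⟩
      simp only [e]
      rw [iteratedFDeriv_const_smul_apply (hs.of_le (by exact_mod_cast le_top)).contDiffAt,
        norm_smul]
      by_cases h : k = q.1
      · rw [if_pos h, h, norm_one, one_mul]
        gcongr
        exact norm_iteratedFDeriv_lift_mFourier_le _ _ _
      · rw [if_neg h, norm_zero, zero_mul, mul_zero]
        positivity⟩

theorem basisFn_apply {n : ℕ} (q : Zn n × Zn n) (p : Zn n × Tn n) :
    (basisFn q).1 p = if p.1 = q.1 then UnitAddTorus.mFourier q.2 p.2 else 0 := rfl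

theorem fc_basisFn {n : ℕ} (p q : Zn n × Zn n) :
    fc (basisFn p).1 q = if q = p then 1 else 0 := by
  simp only [fc, basisFn_apply]
  by_cases h : q.1 = p.1
  · simp only [h, if_true, ← UnitAddTorus.mFourier_add]
    by_cases h2 : q.2 = p.2
    · rw [if_pos (Prod.ext h h2), h2, neg_add_cancel, integral_mFourier_zero]
    · rw [if_neg fun hq => h2 (congrArg Prod.snd hq)]
      exact integral_mFourier fun h0 => h2 (neg_add_eq_zero.1 h0)
  · simp only [h, if_false, mul_zero, integral_zero]
    rw [if_neg fun hq => h (congrArg Prod.fst hq)]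

/-- The distribution `Ψ ↦ ∫ Ψ(k, y) e^{-2πi j·y} dy`, for `q = (k, j)`. -/
def basisDist {n : ℕ} (q : Zn n × Zn n) : temperedZT n :=
  ⟨{ toFun := fun Ψ => fc Ψ.1 q
     map_add' := fun Ψ Θ => fc_add Ψ Θ q
     map_smul' := fun c Ψ => fc_smul c Ψ q }, 0, 1, zero_le_one, fun Ψ B hB => by
    rw [one_mul]
    refine norm_fc_le q fun y => ?_
    obtain ⟨x, rfl⟩ := (isOpenQuotientMap_toTorus n).surjective y
    simpa [lift_apply] using hB 0 le_rfl q.1 x⟩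

theorem basisDist_apply {n : ℕ} (q : Zn n × Zn n) (Ψ : schwartzZT n) :
    (basisDist q).1 Ψ = fc Ψ.1 q := rfl

/-- The seminorms of a Schwartz function are bounded by weighted `ℓ¹` norms of its Fourier
coefficients. -/
theorem seminorm_le_tsum_fc {n : ℕ} (Ψ : schwartzZT n) {i N : ℕ} (hi : i ≤ N) (k : Zn n)
    (x : Fin n → ℝ) :
    (1 + ‖k‖) ^ N * ‖iteratedFDeriv ℝ i (lift fun y => Ψ.1 (k, y)) x‖ ≤
      (2 * Real.pi * (n + 1)) ^ N *
        ∑' q : Zn n × Zn n, (1 + ‖q.1‖) ^ N * (1 + ‖q.2‖) ^ N * ‖fc Ψ.1 q‖ := by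
  have hA : 1 ≤ 2 * Real.pi * ((n : ℝ) + 1) := by
    have : (0 : ℝ) ≤ n := by positivity
    nlinarith [Real.pi_gt_three]
  set A := 2 * Real.pi * ((n : ℝ) + 1) with hAdef
  have hinj : Function.Injective fun j : Zn n => (k, j) := fun _ _ h => (Prod.ext_iff.1 h).2
  have hw : ∀ l : ℕ, Summable fun j => ‖fc Ψ.1 (k, j)‖ * (A * (1 + ‖j‖)) ^ l := fun l => by
    refine (((summable_fc_weight 0 l Ψ).comp_injective hinj).mul_left (A ^ l)).congr fun j => ?_
    simp only [Function.comp, pow_zero, one_mul, mul_pow]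
    ring
  have hf : ∀ j, ContDiff ℝ ∞ (fc Ψ.1 (k, j) • lift fun y => UnitAddTorus.mFourier j y) :=
    fun j => (contDiff_lift_mFourier j).const_smul (fc Ψ.1 (k, j))
  have hb : ∀ (l : ℕ) (j : Zn n) (x : Fin n → ℝ),
      ‖iteratedFDeriv ℝ l (fc Ψ.1 (k, j) • lift fun y => UnitAddTorus.mFourier j y) x‖ ≤
        ‖fc Ψ.1 (k, j)‖ * (A * (1 + ‖j‖)) ^ l := fun l j x => by
    rw [iteratedFDeriv_const_smul_apply
      ((contDiff_lift_mFourier j).of_le (by exact_mod_cast le_top)).contDiffAt, norm_smul]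
    gcongr
    exact norm_iteratedFDeriv_lift_mFourier_le j l x
  have e : (lift fun y => Ψ.1 (k, y)) = fun x =>
      ∑' j, (fc Ψ.1 (k, j) • lift fun y => UnitAddTorus.mFourier j y) x := by
    funext x
    exact (hasSum_fc Ψ k (toTorus x)).tsum_eq.symm
  rw [e, iteratedFDeriv_tsum_apply (N := ⊤) (v := fun l j => ‖fc Ψ.1 (k, j)‖ * (A * (1 + ‖j‖)) ^ l)
    (fun j => by exact_mod_cast hf j) (fun l _ => hw l) (fun l j x _ => hb l j x)
    (by exact_mod_cast le_top) x]
  have hle := tsum_of_norm_bounded (hw i).hasSum fun j => hb i j x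
  set g : Zn n × Zn n → ℝ := fun q => (1 + ‖q.1‖) ^ N * (1 + ‖q.2‖) ^ N * ‖fc Ψ.1 q‖
  have hg : Summable g := summable_fc_weight N N Ψ
  calc _ ≤ (1 + ‖k‖) ^ N * ∑' j, ‖fc Ψ.1 (k, j)‖ * (A * (1 + ‖j‖)) ^ i := by gcongr
    _ ≤ (1 + ‖k‖) ^ N * ∑' j, ‖fc Ψ.1 (k, j)‖ * (A * (1 + ‖j‖)) ^ N := by
        gcongr with j
        · exact hw i
        · exact hw N
        · nlinarith [norm_nonneg j]
    _ = A ^ N * ∑' j, g (k, j) := by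
        rw [← tsum_mul_left, ← tsum_mul_left]
        refine tsum_congr fun j => ?_
        simp only [g, mul_pow]
        ring
    _ ≤ A ^ N * ∑' q, g q := by
        gcongr
        exact _root_.tsum_comp_le_tsum_of_inj hg (fun _ => by positivity) hinj

/-- A tempered distribution acts on a Schwartz function through its Fourier coefficients. -/
theorem hasSum_distribution {n : ℕ} (u : temperedZT n) (Ψ : schwartzZT n) :
    HasSum (fun q => fc Ψ.1 q * u.1 (basisFn q)) (u.1 Ψ) := by
  classical
  obtain ⟨N, C, hC, hu⟩ := u.2
  set A := (2 * Real.pi * ((n : ℝ) + 1)) ^ N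
  set g : Zn n × Zn n → ℝ := fun q => (1 + ‖q.1‖) ^ N * (1 + ‖q.2‖) ^ N * ‖fc Ψ.1 q‖ with hg
  have hlim := ((tendsto_tsum_compl_atTop_zero g).const_mul A).const_mul C
  rw [mul_zero, mul_zero] at hlim
  refine tendsto_iff_norm_sub_tendsto_zero.2 (squeeze_zero (fun _ => norm_nonneg _) (fun F => ?_)
    hlim)
  set R : schwartzZT n := Ψ - ∑ q ∈ F, fc Ψ.1 q • basisFn q with hR
  have h1 : ‖∑ q ∈ F, fc Ψ.1 q * u.1 (basisFn q) - u.1 Ψ‖ = ‖u.1 R‖ := by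
    rw [norm_sub_rev, hR, map_sub, map_sum]
    simp
  have hfc : ∀ q, fc R.1 q = if q ∈ F then 0 else fc Ψ.1 q := fun q => by
    rw [← basisDist_apply, hR, map_sub, map_sum]
    simp only [map_smul, basisDist_apply, fc_basisFn, smul_eq_mul, mul_ite, mul_one, mul_zero,
      Finset.sum_ite_eq]
    split_ifs <;> simp
  rw [h1]
  refine (hu R _ fun i hi k x => seminorm_le_tsum_fc R hi k x).trans_eq ?_
  congr 2
  have h2 := tsum_subtype {q | q ∉ F} g
  refine Eq.trans (tsum_congr fun q => ?_) h2.symm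
  rw [hfc, Set.indicator_apply]
  by_cases hq : q ∈ F <;> simp [hq, hg]

theorem fc_conjShift {n : ℕ} (Φ : schwartzZT n) (a : (Zn n × Tn n) × (Tn n × Zn n))
    (q : Zn n × Zn n) :
    fc (conjShift Φ a.1 a.2).1 q =
      conj (fc Φ.1 (q.1 - a.1.1, -(q.2 + a.2.2))) *
        (UnitAddTorus.mFourier (-(q.2 + a.2.2)) a.1.2 * UnitAddTorus.mFourier (-q.1) a.2.1) := by
  obtain ⟨⟨m, w⟩, ⟨x, ζ⟩⟩ := a
  obtain ⟨k, j⟩ := q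
  simp only [fc, conjShift, tfShiftZT, Prod.mk_sub_mk, neg_neg]
  rw [← integral_conj, ← integral_mul_const, ← integral_add_right_eq_self (μ := torusMeasure n) _ w]
  refine integral_congr_ae (Filter.Eventually.of_forall fun y => ?_)
  simp only [map_mul, conj_mFourier, mFourier_apply_add, add_sub_cancel_right, neg_add,
    UnitAddTorus.mFourier_add]
  ring

/-- The short-time Fourier transform of a tempered distribution as a Fourier series. -/
theorem hasSum_stftZT {n : ℕ} (Φ : schwartzZT n) (u : temperedZT n)
    (a : (Zn n × Tn n) × (Tn n × Zn n)) :
    HasSum (fun q => conj (fc Φ.1 (q.1 - a.1.1, -(q.2 + a.2.2))) * u.1 (basisFn q) *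
      (UnitAddTorus.mFourier (-(q.2 + a.2.2)) a.1.2 * UnitAddTorus.mFourier (-q.1) a.2.1))
      (stftZT Φ u a) := by
  refine (hasSum_distribution u (conjShift Φ a.1 a.2)).congr_fun fun q => ?_
  rw [fc_conjShift]
  ring

theorem isGivenBy_basisDist {n : ℕ} (q : Zn n × Zn n) :
    IsGivenBy (basisDist q) (basisFn (q.1, -q.2)).1 := by
  intro Ψ
  rw [tsum_eq_single q.1]
  · simp [basisDist_apply, fc, basisFn_apply]
  · intro m hm
    simp [basisFn_apply, hm]

theorem lintegral_doublePhase {n : ℕ} {F : (Zn n × Tn n) × (Tn n × Zn n) → ℝ≥0∞}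
    (hF : Measurable F) :
    ∫⁻ a, F a ∂doublePhaseMeasure n = ∑' q : Zn n × Zn n,
      ∫⁻ y, F ((q.1, y.1), (y.2, q.2)) ∂(torusMeasure n).prod (torusMeasure n) := by
  have h1 : ∀ m ζ, Measurable fun y : Tn n × Tn n => F ((m, y.1), (y.2, ζ)) := fun m ζ =>
    hF.comp (by fun_prop)
  rw [doublePhaseMeasure, lintegral_prod _ hF.aemeasurable, phaseMeasure,
    lintegral_prod _ hF.lintegral_prod_right'.aemeasurable, lintegral_count,
    ENNReal.tsum_prod (f := fun m ζ => ∫⁻ y : Tn n × Tn n, F ((m, y.1), (y.2, ζ))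
      ∂(torusMeasure n).prod (torusMeasure n))]
  refine tsum_congr fun m => ?_
  have h2 : ∀ w, ∫⁻ ξ, F ((m, w), ξ) ∂(torusMeasure n).prod Measure.count =
      ∑' ζ, ∫⁻ x, F ((m, w), (x, ζ)) ∂torusMeasure n := fun w => by
    rw [lintegral_prod_symm (fun ξ => F ((m, w), ξ)) (hF.comp (by fun_prop)).aemeasurable,
      lintegral_count]
  simp only [h2]
  rw [lintegral_tsum fun ζ => (h1 m ζ).lintegral_prod_right'.aemeasurable]
  exact tsum_congr fun ζ => (lintegral_prod _ (h1 m ζ).aemeasurable).symm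

theorem measurable_mFourier_prod (n : ℕ) :
    Measurable fun p : Zn n × Tn n => UnitAddTorus.mFourier p.1 p.2 :=
  measurable_from_prod_countable_right fun j => (UnitAddTorus.mFourier j).continuous.measurable

theorem measurable_mFourier_comp {n : ℕ} {X : Type*} [MeasurableSpace X] {f : X → Zn n}
    {g : X → Tn n} (hf : Measurable f) (hg : Measurable g) :
    Measurable fun a => UnitAddTorus.mFourier (f a) (g a) := by
  have hfg : Measurable fun a => (f a, g a) := hf.prodMk hg
  have h := (measurable_mFourier_prod n).comp hfg
  simp only [Function.comp_def] at h
  exact h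

theorem measurable_stftZT {n : ℕ} (Φ : schwartzZT n) (u : temperedZT n) :
    Measurable (stftZT Φ u) := by
  have he : stftZT Φ u = fun a => ∑' q : Zn n × Zn n,
      conj (fc Φ.1 (q.1 - a.1.1, -(q.2 + a.2.2))) * u.1 (basisFn q) *
      (UnitAddTorus.mFourier (-(q.2 + a.2.2)) a.1.2 * UnitAddTorus.mFourier (-q.1) a.2.1) := by
    funext a
    exact (hasSum_stftZT Φ u a).tsum_eq.symm
  rw [he]
  refine Measurable.tsum fun q => ?_
  have hF : Measurable fun p : Zn n × Zn n => conj (fc Φ.1 (q.1 - p.1, -(q.2 + p.2))) :=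
    Measurable.of_discrete
  have hG : Measurable fun j : Zn n => -(q.2 + j) := Measurable.of_discrete
  have hm : Measurable fun a : (Zn n × Tn n) × (Tn n × Zn n) => a.1.1 := by fun_prop
  have hw : Measurable fun a : (Zn n × Tn n) × (Tn n × Zn n) => a.1.2 := by fun_prop
  have hx : Measurable fun a : (Zn n × Tn n) × (Tn n × Zn n) => a.2.1 := by fun_prop
  have hz : Measurable fun a : (Zn n × Tn n) × (Tn n × Zn n) => a.2.2 := by fun_prop
  exact ((hF.comp (hm.prodMk hz)).mul_const _).mul
    ((measurable_mFourier_comp (hG.comp hz) hw).mul (measurable_mFourier_comp measurable_const hx))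

theorem enorm_fc_mul_le_lintegral {n : ℕ} (Φ : schwartzZT n) (u : temperedZT n)
    (p q : Zn n × Zn n) :
    ‖fc Φ.1 p‖ₑ * ‖u.1 (basisFn q)‖ₑ ≤ ∫⁻ y,
      ‖stftZT Φ u ((q.1 - p.1, y.1), (y.2, -q.2 - p.2))‖ₑ
        ∂(torusMeasure n).prod (torusMeasure n) := by
  set m := q.1 - p.1
  set ζ := -q.2 - p.2
  set c : Zn n × Zn n → ℂ := fun l => conj (fc Φ.1 (l.1 - m, -(l.2 + ζ))) * u.1 (basisFn l)
  set χ : Zn n × Zn n → Tn n × Tn n → ℂ := fun l y =>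
    UnitAddTorus.mFourier (-(l.2 + ζ)) y.1 * UnitAddTorus.mFourier (-l.1) y.2 with hχ
  have hs : ∀ y : Tn n × Tn n, HasSum (fun l => c l * χ l y) (stftZT Φ u ((m, y.1), (y.2, ζ))) :=
    fun y => hasSum_stftZT Φ u ((m, y.1), (y.2, ζ))
  have h1 : ∀ l y, ‖χ l y‖ = 1 := fun l y => by simp [hχ, norm_mFourier_apply]
  have hc : Summable c := by
    refine Summable.of_norm ((hs 0).summable.norm.congr fun l => ?_)
    rw [norm_mul, h1, mul_one]
  have hm : ∀ l, AEStronglyMeasurable (χ l) ((torusMeasure n).prod (torusMeasure n)) := fun l =>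
    (((UnitAddTorus.mFourier (-(l.2 + ζ))).continuous.comp continuous_fst).mul
      ((UnitAddTorus.mFourier (-l.1)).continuous.comp continuous_snd)).aestronglyMeasurable
  have ho : ∀ l, l ≠ q → ∫ y, χ l y * conj (χ q y) ∂(torusMeasure n).prod (torusMeasure n) = 0 := by
    intro l hl
    have he : ∀ y, χ l y * conj (χ q y) =
        UnitAddTorus.mFourier (q.2 - l.2) y.1 * UnitAddTorus.mFourier (q.1 - l.1) y.2 := fun y => by
      simp only [hχ, map_mul, conj_mFourier]
      rw [mul_mul_mul_comm, ← UnitAddTorus.mFourier_add, ← UnitAddTorus.mFourier_add]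
      congr 3 <;> abel_nf
    simp only [he]
    rw [integral_prod_mul (fun y => UnitAddTorus.mFourier (q.2 - l.2) y)
      (fun y => UnitAddTorus.mFourier (q.1 - l.1) y)]
    by_cases h : l.1 = q.1
    · have h2 : q.2 - l.2 ≠ 0 := fun h2 => hl (Prod.ext h (sub_eq_zero.1 h2).symm)
      rw [integral_mFourier h2, zero_mul]
    · have h2 : q.1 - l.1 ≠ 0 := fun h2 => h (sub_eq_zero.1 h2).symm
      rw [integral_mFourier h2, mul_zero]
  have h := enorm_coeff_le_lintegral hm h1 q ho hc
  have hcq : ‖c q‖ₑ = ‖fc Φ.1 p‖ₑ * ‖u.1 (basisFn q)‖ₑ := by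
    have : (q.1 - m, -(q.2 + ζ)) = p := by ext1 <;> simp [m, ζ]
    simp only [c, this, enorm_mul]
    congr 1
    rw [← ofReal_norm, ← ofReal_norm, RCLike.norm_conj]
  rw [hcq] at h
  simpa only [(hs _).tsum_eq] using h

theorem lintegral_rpow_le_of_isProbabilityMeasure {X : Type*} [MeasurableSpace X] {μ : Measure X}
    [IsProbabilityMeasure μ] {f : X → ℂ} (hf : AEStronglyMeasurable f μ) {r : ℝ} (hr : 1 ≤ r) :
    (∫⁻ x, ‖f x‖ₑ ∂μ) ^ r ≤ ∫⁻ x, ‖f x‖ₑ ^ r ∂μ := by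
  have h0 : 0 < r := by linarith
  have h := eLpNorm_le_eLpNorm_of_exponent_le (p := 1) (q := ENNReal.ofReal r)
    (by simpa using hr) hf
  rw [eLpNorm_one_eq_lintegral_enorm, eLpNorm_eq_lintegral_rpow_enorm_toReal (by simpa using h0)
    (by simp), ENNReal.toReal_ofReal h0.le] at h
  rwa [← ENNReal.le_rpow_inv_iff h0, inv_eq_one_div]

theorem fc_mul_tsum_rpow_le {n : ℕ} (Φ : schwartzZT n) (u : temperedZT n) (p : Zn n × Zn n)
    {r : ℝ} (hr : 1 ≤ r) :
    ∑' q, (‖fc Φ.1 p‖ₑ * ‖u.1 (basisFn q)‖ₑ) ^ r ≤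
      ∫⁻ a, ‖stftZT Φ u a‖ₑ ^ r ∂doublePhaseMeasure n := by
  rw [lintegral_doublePhase ((measurable_stftZT Φ u).enorm.pow_const r)]
  have hinj : Function.Injective fun q : Zn n × Zn n => (q.1 - p.1, -q.2 - p.2) := by
    rintro ⟨a, b⟩ ⟨c, d⟩ h
    simpa using h
  refine le_trans (ENNReal.tsum_le_tsum fun q => ?_) (ENNReal.tsum_comp_le_tsum_of_injective hinj _)
  refine (ENNReal.rpow_le_rpow (enorm_fc_mul_le_lintegral Φ u p q) (by linarith)).trans
    (lintegral_rpow_le_of_isProbabilityMeasure ?_ hr)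
  exact ((measurable_stftZT Φ u).comp (by fun_prop)).aestronglyMeasurable

theorem tsum_mul_rpow_le {ι : Type*} (w f : ι → ℝ≥0∞) {r : ℝ} (hr : 1 ≤ r) :
    (∑' i, w i * f i) ^ r ≤ (∑' i, w i) ^ (r - 1) * ∑' i, w i * f i ^ r := by
  have h0 : 0 < r := by linarith
  have h : ∑' i, w i * f i ≤ (∑' i, w i) ^ (1 - r⁻¹) * (∑' i, w i * f i ^ r) ^ r⁻¹ := by
    rw [ENNReal.tsum_eq_iSup_sum]
    refine iSup_le fun s => (ENNReal.inner_le_weight_mul_Lp_of_nonneg s hr w f).trans ?_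
    gcongr
    · exact sub_nonneg.2 (inv_le_one_of_one_le₀ hr)
    · exact ENNReal.sum_le_tsum s
    · exact ENNReal.sum_le_tsum s
  refine (ENNReal.rpow_le_rpow h h0.le).trans_eq ?_
  rw [ENNReal.mul_rpow_of_nonneg _ _ h0.le, ← ENNReal.rpow_mul, ← ENNReal.rpow_mul,
    inv_mul_cancel₀ h0.ne', ENNReal.rpow_one, sub_mul, one_mul, inv_mul_cancel₀ h0.ne']

theorem lintegral_stftZT_rpow_le {n : ℕ} (Φ : schwartzZT n) (u : temperedZT n)
    {r : ℝ} (hr : 1 ≤ r) :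
    ∫⁻ a, ‖stftZT Φ u a‖ₑ ^ r ∂doublePhaseMeasure n ≤
      (∑' q, ‖fc Φ.1 q‖ₑ) ^ r * ∑' q, ‖u.1 (basisFn q)‖ₑ ^ r := by
  set B := ∑' q, ‖fc Φ.1 q‖ₑ with hB
  rw [lintegral_doublePhase ((measurable_stftZT Φ u).enorm.pow_const r)]
  have hB1 : ∀ z : Zn n × Zn n, ∑' q : Zn n × Zn n, ‖fc Φ.1 (q.1 - z.1, -(q.2 + z.2))‖ₑ ≤ B :=
    fun z => ENNReal.tsum_comp_le_tsum_of_injective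
      (f := fun q : Zn n × Zn n => (q.1 - z.1, -(q.2 + z.2)))
      (by rintro ⟨a, b⟩ ⟨c, d⟩ h; simpa using h) (fun q => ‖fc Φ.1 q‖ₑ)
  have hB2 : ∀ q : Zn n × Zn n, ∑' z : Zn n × Zn n, ‖fc Φ.1 (q.1 - z.1, -(q.2 + z.2))‖ₑ ≤ B :=
    fun q => ENNReal.tsum_comp_le_tsum_of_injective
      (f := fun z : Zn n × Zn n => (q.1 - z.1, -(q.2 + z.2)))
      (by rintro ⟨a, b⟩ ⟨c, d⟩ h; simpa using h) (fun q => ‖fc Φ.1 q‖ₑ)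
  have hpt : ∀ (z : Zn n × Zn n) (y : Tn n × Tn n),
      ‖stftZT Φ u ((z.1, y.1), (y.2, z.2))‖ₑ ≤
        ∑' q : Zn n × Zn n, ‖fc Φ.1 (q.1 - z.1, -(q.2 + z.2))‖ₑ * ‖u.1 (basisFn q)‖ₑ := by
    intro z y
    rw [← (hasSum_stftZT Φ u ((z.1, y.1), (y.2, z.2))).tsum_eq]
    refine enorm_tsum_le_tsum_enorm.trans_eq (tsum_congr fun q => ?_)
    simp only [← ofReal_norm, norm_mul, RCLike.norm_conj, norm_mFourier_apply, mul_one,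
      ENNReal.ofReal_mul (norm_nonneg _)]
  calc _ ≤ ∑' z : Zn n × Zn n, B ^ (r - 1) *
        ∑' q : Zn n × Zn n, ‖fc Φ.1 (q.1 - z.1, -(q.2 + z.2))‖ₑ * ‖u.1 (basisFn q)‖ₑ ^ r := by
        refine ENNReal.tsum_le_tsum fun z => ?_
        refine (lintegral_mono fun y => ?_).trans_eq
          ((lintegral_const _).trans (by rw [measure_univ, mul_one]))
        refine (ENNReal.rpow_le_rpow (hpt z y) (by linarith)).trans
          ((tsum_mul_rpow_le _ _ hr).trans ?_)
        gcongr
        exact hB1 z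
    _ = B ^ (r - 1) * ∑' q : Zn n × Zn n, (∑' z : Zn n × Zn n,
          ‖fc Φ.1 (q.1 - z.1, -(q.2 + z.2))‖ₑ) * ‖u.1 (basisFn q)‖ₑ ^ r := by
        rw [ENNReal.tsum_mul_left, ENNReal.tsum_comm]
        simp only [ENNReal.tsum_mul_right]
    _ ≤ B ^ (r - 1) * ∑' q : Zn n × Zn n, B * ‖u.1 (basisFn q)‖ₑ ^ r := by
        gcongr with q
        exact hB2 q
    _ = _ := by
        rw [ENNReal.tsum_mul_left, ← mul_assoc]
        congr 1
        conv_lhs => rw [← ENNReal.rpow_one B, ← ENNReal.rpow_mul, one_mul]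
        rw [← ENNReal.rpow_add_of_nonneg _ _ (by linarith) zero_le_one, sub_add_cancel]

theorem tsum_enorm_fc_ne_top {n : ℕ} (Φ : schwartzZT n) : ∑' q, ‖fc Φ.1 q‖ₑ ≠ ⊤ := by
  simpa only [← ofReal_norm] using (summable_norm_fc Φ).tsum_ofReal_ne_top

theorem eLpNorm_stftZT_le {n : ℕ} (Φ : schwartzZT n) (u : temperedZT n) {p : ℝ≥0∞} (hp : 1 ≤ p)
    (hp' : p ≠ ⊤) :
    eLpNorm (stftZT Φ u) p (doublePhaseMeasure n) ≤
      (∑' q, ‖fc Φ.1 q‖ₑ) * (∑' q, ‖u.1 (basisFn q)‖ₑ ^ p.toReal) ^ (1 / p.toReal) := by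
  have hr : 1 ≤ p.toReal := by
    rw [← ENNReal.toReal_one]
    exact ENNReal.toReal_mono hp' hp
  have h0 : 0 < p.toReal := by linarith
  rw [eLpNorm_eq_lintegral_rpow_enorm_toReal (by positivity) hp']
  refine (ENNReal.rpow_le_rpow (lintegral_stftZT_rpow_le Φ u hr) (by positivity)).trans_eq ?_
  rw [ENNReal.mul_rpow_of_nonneg _ _ (by positivity), ← ENNReal.rpow_mul,
    mul_one_div_cancel h0.ne', ENNReal.rpow_one]

theorem enorm_fc_mul_le_eLpNorm {n : ℕ} (Φ : schwartzZT n) (u : temperedZT n) (q₀ q : Zn n × Zn n)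
    {p : ℝ≥0∞} (hp : 1 ≤ p) (hp' : p ≠ ⊤) :
    ‖fc Φ.1 q₀‖ₑ * ‖u.1 (basisFn q)‖ₑ ≤ eLpNorm (stftZT Φ u) p (doublePhaseMeasure n) := by
  have hr : 1 ≤ p.toReal := by
    rw [← ENNReal.toReal_one]
    exact ENNReal.toReal_mono hp' hp
  have h0 : 0 < p.toReal := by linarith
  rw [eLpNorm_eq_lintegral_rpow_enorm_toReal (by positivity) hp', ← inv_eq_one_div,
    ENNReal.le_rpow_inv_iff h0]
  exact (ENNReal.le_tsum q).trans (fc_mul_tsum_rpow_le Φ u q₀ hr)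

/-- The coefficients of a distribution in `M^p` are `p`-summable. -/
theorem tsum_basisFn_rpow_ne_top {n : ℕ} {Φ : schwartzZT n} (hΦ : Φ ≠ 0) {p : ℝ≥0∞} (hp : 1 ≤ p)
    (hp' : p ≠ ⊤) (u : modZT Φ p) : ∑' q, ‖u.1.1 (basisFn q)‖ₑ ^ p.toReal ≠ ⊤ := by
  have hr : 1 ≤ p.toReal := by
    rw [← ENNReal.toReal_one]
    exact ENNReal.toReal_mono hp' hp
  have h0 : 0 < p.toReal := by linarith
  obtain ⟨q₀, hq₀⟩ := exists_fc_ne_zero hΦ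
  have h := fc_mul_tsum_rpow_le Φ u.1 q₀ hr
  have hfin : ∫⁻ a, ‖stftZT Φ u.1 a‖ₑ ^ p.toReal ∂doublePhaseMeasure n < ⊤ :=
    lintegral_rpow_enorm_lt_top_of_eLpNorm_lt_top (by positivity) hp' u.2.2
  simp only [ENNReal.mul_rpow_of_nonneg _ _ h0.le, ENNReal.tsum_mul_left] at h
  intro htop
  rw [htop, ENNReal.mul_top (by simp [hq₀])] at h
  exact absurd (h.trans_lt hfin) (by simp)

theorem basisDist_mem_modZT {n : ℕ} (Φ : schwartzZT n) (q : Zn n × Zn n) {p : ℝ≥0∞} (hp : 1 ≤ p) :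
    basisDist q ∈ modZT Φ p := by
  have hm := (measurable_stftZT Φ (basisDist q)).aestronglyMeasurable (μ := doublePhaseMeasure n)
  by_cases hp' : p = ⊤
  · subst hp'
    refine memLp_top_of_bound hm (∑' q, ‖fc Φ.1 q‖) (Filter.Eventually.of_forall fun a => ?_)
    have : stftZT Φ (basisDist q) a = fc (conjShift Φ a.1 a.2).1 q := rfl
    rw [this, fc_conjShift]
    simp only [norm_mul, RCLike.norm_conj, norm_mFourier_apply, mul_one]
    exact (summable_norm_fc Φ).le_tsum _ fun _ _ => norm_nonneg _
  · refine ⟨hm, (eLpNorm_stftZT_le Φ _ hp hp').trans_lt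
      (ENNReal.mul_lt_top (tsum_enorm_fc_ne_top Φ).lt_top ?_)⟩
    have hr : 0 < p.toReal := ENNReal.toReal_pos (by positivity) hp'
    rw [tsum_eq_single q]
    · simp [basisDist_apply, fc_basisFn]
    · intro l hl
      simp [basisDist_apply, fc_basisFn, hl.symm, hr]

/-! The modulation space `M¹(ℤⁿ)` is contained in `ℓ¹(ℤⁿ)`. -/

theorem summable_tempered_mul_schwartz {n : ℕ} {φ g : Zn n → ℂ} (hφ : IsSchwartz φ)
    (hg : IsTempered g) (m : Zn n) : Summable fun l => g l * conj (φ (l - m)) := by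
  obtain ⟨M, C, hC⟩ := hg
  obtain ⟨D, hD⟩ := hφ (M + 2 * n)
  have hC0 : 0 ≤ C := by simpa using (norm_nonneg _).trans (hC 0)
  have hs := ((summable_weight n).comp_injective (sub_left_injective (b := m))).mul_left
    (C * (1 + ‖m‖) ^ M * D)
  refine Summable.of_norm (hs.of_nonneg_of_le (fun _ => norm_nonneg _) fun l => ?_)
  rw [norm_mul, RCLike.norm_conj]
  have hl : 1 + ‖l‖ ≤ (1 + ‖m‖) * (1 + ‖l - m‖) := by
    have : ‖l‖ ≤ ‖l - m‖ + ‖m‖ := by simpa using norm_add_le (l - m) m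
    nlinarith [norm_nonneg m, norm_nonneg (l - m)]
  simp only [Function.comp]
  rw [← div_eq_mul_inv, le_div_iff₀ (by positivity)]
  calc ‖g l‖ * ‖φ (l - m)‖ * (1 + ‖l - m‖) ^ (2 * n)
      ≤ C * ((1 + ‖m‖) * (1 + ‖l - m‖)) ^ M * ‖φ (l - m)‖ * (1 + ‖l - m‖) ^ (2 * n) := by
        gcongr
        exact (hC l).trans (by gcongr)
    _ = C * (1 + ‖m‖) ^ M * ((1 + ‖l - m‖) ^ (M + 2 * n) * ‖φ (l - m)‖) := by
        rw [mul_pow]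
        ring
    _ ≤ _ := by
        gcongr
        exact hD (l - m)

theorem enorm_mul_le_lintegral_stft {n : ℕ} {φ g : Zn n → ℂ} (hφ : IsSchwartz φ)
    (hg : IsTempered g) (j k : Zn n) :
    ‖φ j‖ₑ * ‖g k‖ₑ ≤ ∫⁻ w, ‖stft φ g (k - j, w)‖ₑ ∂torusMeasure n := by
  have h := enorm_coeff_le_lintegral (μ := torusMeasure n)
    (χ := fun l w => UnitAddTorus.mFourier (-l) w)
    (fun l => (UnitAddTorus.mFourier (-l)).continuous.aestronglyMeasurable)
    (fun l w => norm_mFourier_apply _ _) k (fun l hl => ?_)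
    (summable_tempered_mul_schwartz hφ hg (k - j))
  · have h1 : ‖g k * conj (φ (k - (k - j)))‖ₑ = ‖φ j‖ₑ * ‖g k‖ₑ := by
      rw [sub_sub_cancel, enorm_mul, mul_comm, ← ofReal_norm (conj (φ j)), RCLike.norm_conj,
        ofReal_norm]
    rw [h1] at h
    refine h.trans_eq (lintegral_congr fun w => ?_)
    congr 1
    refine tsum_congr fun l => ?_
    simp only [tfShift, map_mul, conj_mFourier]
    ring
  · simp only [conj_mFourier, ← UnitAddTorus.mFourier_add]
    exact integral_mFourier fun h0 => hl (by simpa [neg_add_eq_zero] using h0)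

theorem mul_tsum_enorm_le {n : ℕ} {φ g : Zn n → ℂ} (hφ : IsSchwartz φ) (hg : MemMod φ 1 g)
    (j : Zn n) : ‖φ j‖ₑ * ∑' k, ‖g k‖ₑ ≤ eLpNorm (stft φ g) 1 (phaseMeasure n) := by
  rw [eLpNorm_one_eq_lintegral_enorm, phaseMeasure, lintegral_prod _ hg.2.1.enorm,
    lintegral_count, ← ENNReal.tsum_mul_left]
  refine (ENNReal.tsum_le_tsum fun k => enorm_mul_le_lintegral_stft hφ hg.1 j k).trans ?_
  exact ENNReal.tsum_comp_le_tsum_of_injective (f := fun k : Zn n => k - j) sub_left_injective _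

theorem MemMod.summable_norm {n : ℕ} {φ g : Zn n → ℂ} (hφ : IsSchwartz φ) (hg : MemMod φ 1 g)
    {j : Zn n} (hj : φ j ≠ 0) : Summable fun k => ‖g k‖ := by
  have h := (mul_tsum_enorm_le hφ hg j).trans_lt hg.2.2
  have hfin : ∑' k, ‖g k‖ₑ ≠ ⊤ := fun htop => by
    rw [htop, ENNReal.mul_top (by simpa using hj)] at h
    exact absurd h (by simp)
  simpa using ENNReal.summable_toReal hfin

theorem MemMod.tsum_norm_le {n : ℕ} {φ g : Zn n → ℂ} (hφ : IsSchwartz φ) (hg : MemMod φ 1 g)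
    {j : Zn n} (hj : φ j ≠ 0) : ∑' k, ‖g k‖ ≤ ‖φ j‖⁻¹ * modNorm φ 1 g := by
  have h := ENNReal.toReal_mono hg.2.2.ne (mul_tsum_enorm_le hφ hg j)
  rw [ENNReal.toReal_mul, ENNReal.tsum_toReal_eq fun _ => enorm_ne_top] at h
  simp only [toReal_enorm] at h
  rw [← div_eq_inv_mul, le_div_iff₀' (norm_pos_iff.2 hj)]
  exact h

/-! Localization operators with Fourier coefficients `u` of the symbol. -/

theorem exists_weightedShift {n : ℕ} {v : Zn n → ℂ} {B : ℝ} (hv : ∀ k, ‖v k‖ ≤ B) (d : Zn n) :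
    ∃ T : ell2 n →L[ℂ] ell2 n, ‖T‖ ≤ B ∧ ∀ (f : ell2 n) k, T f k = v k * f (k + d) := by
  have hB : 0 ≤ B := (norm_nonneg _).trans (hv 0)
  have h2 : (0 : ℝ) < (2 : ℝ≥0∞).toReal := by norm_num
  have hle : ∀ (f : ell2 n) k, ‖v k * f (k + d)‖ ^ (2 : ℝ≥0∞).toReal ≤
      B ^ (2 : ℝ≥0∞).toReal * ‖f (k + d)‖ ^ (2 : ℝ≥0∞).toReal := fun f k => by
    rw [← Real.mul_rpow hB (norm_nonneg _), norm_mul]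
    gcongr
    exact hv k
  have hsum : ∀ f : ell2 n, Summable fun k => ‖f (k + d)‖ ^ (2 : ℝ≥0∞).toReal := fun f =>
    ((lp.memℓp f).summable h2).comp_injective (add_left_injective d)
  have hmem : ∀ f : ell2 n, Memℓp (fun k => v k * f (k + d)) 2 := fun f =>
    (memℓp_gen_iff h2).2 (((hsum f).mul_left _).of_nonneg_of_le (fun _ => by positivity) (hle f))
  let T₀ : ell2 n →ₗ[ℂ] ell2 n :=
    { toFun := fun f => ⟨fun k => v k * f (k + d), hmem f⟩
      map_add' := fun f g => lp.ext (funext fun k => mul_add _ _ _)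
      map_smul' := fun c f => lp.ext (funext fun k => mul_left_comm _ _ _) }
  have hT : ∀ f, ‖T₀ f‖ ≤ B * ‖f‖ := fun f => by
    refine lp.norm_le_of_tsum_le h2 (by positivity) ?_
    rw [Real.mul_rpow hB (norm_nonneg _), lp.norm_rpow_eq_tsum h2,
      ← (Equiv.addRight d).tsum_eq (fun k => ‖f k‖ ^ (2 : ℝ≥0∞).toReal), ← tsum_mul_left]
    exact Summable.tsum_le_tsum (hle f)
      ((memℓp_gen_iff h2).1 (hmem f)) ((hsum f).mul_left _)
  exact ⟨T₀.mkContinuous B hT, T₀.mkContinuous_norm_le hB hT, fun f k => rfl⟩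

theorem exists_locOp {n : ℕ} {g₁ g₂ : Zn n → ℂ} (h₁ : Summable fun k => ‖g₁ k‖)
    (h₂ : Summable fun k => ‖g₂ k‖) {u : Zn n × Zn n → ℂ} {B : ℝ} (hu : ∀ q, ‖u q‖ ≤ B) :
    ∃ T : ell2 n →L[ℂ] ell2 n, ‖T‖ ≤ B * (∑' k, ‖g₁ k‖) * ∑' k, ‖g₂ k‖ ∧
      ∀ (f : ell2 n) k, HasSum (fun p : Zn n × Zn n => conj (g₁ p.1) * g₂ p.2 *
        (u (k - p.2, p.2 - p.1) * f (k + (p.1 - p.2)))) (T f k) := by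
  choose W hW hWf using fun p : Zn n × Zn n =>
    exists_weightedShift (fun k => hu (k - p.2, p.2 - p.1)) (p.1 - p.2)
  have hs := (h₁.mul_of_nonneg h₂ (fun _ => norm_nonneg _) fun _ => norm_nonneg _).mul_left B
  have hle : ∀ p : Zn n × Zn n, ‖(conj (g₁ p.1) * g₂ p.2) • W p‖ ≤ B * (‖g₁ p.1‖ * ‖g₂ p.2‖) :=
    fun p => by
      rw [norm_smul, norm_mul, RCLike.norm_conj, mul_comm B]
      gcongr
      exact hW p
  have hsW : Summable fun p : Zn n × Zn n => (conj (g₁ p.1) * g₂ p.2) • W p :=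
    Summable.of_norm_bounded hs hle
  refine ⟨∑' p : Zn n × Zn n, (conj (g₁ p.1) * g₂ p.2) • W p, ?_, fun f k => ?_⟩
  · refine (tsum_of_norm_bounded hs.hasSum hle).trans_eq ?_
    rw [tsum_mul_left, mul_assoc, tsum_mul_tsum_of_summable_norm h₁.norm h₂.norm]
  · have h := ((lp.evalCLM ℂ (fun _ : Zn n => ℂ) 2 k).comp
      (ContinuousLinearMap.apply ℂ (ell2 n) f)).hasSum hsW.hasSum
    refine h.congr_fun fun p => ?_
    rw [← hWf]
    rfl

theorem integrable_slice {n : ℕ} {s : Zn n × Tn n → ℂ}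
    (hs : MemLp s 1 (phaseMeasure n) ∨ MemLp s ⊤ (phaseMeasure n)) (m : Zn n) :
    Integrable (fun w => s (m, w)) (torusMeasure n) := by
  rcases hs with hs | hs
  · have h := (memLp_one_iff_integrable.1 hs).prod_right_ae
    have h' : ∀ m, Integrable (fun w => s (m, w)) (torusMeasure n) := by simpa using h
    exact h' m
  · have h1 : ∀ m, AEStronglyMeasurable (fun w => s (m, w)) (torusMeasure n) := by
      simpa using hs.1.prodMk_left
    have h2 : ∀ m, ∀ᵐ w ∂torusMeasure n, ‖s (m, w)‖ₑ ≤ eLpNorm s ⊤ (phaseMeasure n) := by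
      have h := Measure.ae_ae_of_ae_prod (ae_le_eLpNormEssSup (f := s) (μ := phaseMeasure n))
      simpa using h
    refine Integrable.of_bound (h1 m) (eLpNorm s ⊤ (phaseMeasure n)).toReal ?_
    filter_upwards [h2 m] with w hw
    simpa using ENNReal.toReal_mono hs.2.ne hw

theorem apply_basisFn_of_isGivenBy {n : ℕ} {σ : temperedZT n} {s : Zn n × Tn n → ℂ}
    (h : IsGivenBy σ s) (q : Zn n × Zn n) :
    σ.1 (basisFn q) = ∫ w, s (q.1, w) * UnitAddTorus.mFourier q.2 w ∂torusMeasure n := by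
  rw [h, tsum_eq_single q.1]
  · simp [basisFn_apply]
  · intro m hm
    simp [basisFn_apply, hm]

theorem hasSum_locOp_integral {n : ℕ} {g₁ g₂ : Zn n → ℂ} (h₁ : Summable fun k => ‖g₁ k‖)
    {s : Zn n × Tn n → ℂ} {m : Zn n} (hs : Integrable (fun w => s (m, w)) (torusMeasure n))
    (f : ell2 n) (k : Zn n) :
    HasSum (fun l => conj (g₁ (l - m)) * g₂ (k - m) *
      ((∫ w, s (m, w) * UnitAddTorus.mFourier (k - l) w ∂torusMeasure n) * f l))
      (∫ w, s (m, w) * stft g₁ f (m, w) * tfShift (m, w) g₂ k ∂torusMeasure n) := by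
  set F : Zn n → Tn n → ℂ := fun l w => conj (g₁ (l - m)) * g₂ (k - m) *
    ((s (m, w) * UnitAddTorus.mFourier (k - l) w) * f l) with hF
  have hint : ∀ l, Integrable (F l) (torusMeasure n) := fun l => by
    refine Integrable.const_mul (Integrable.mul_const ?_ _) _
    refine hs.mul_bdd (c := 1) (UnitAddTorus.mFourier (k - l)).continuous.aestronglyMeasurable ?_
    exact Filter.Eventually.of_forall fun w => (norm_mFourier_apply _ _).le
  have hn : ∀ l, ∫ w, ‖F l w‖ ∂torusMeasure n =
      ‖g₁ (l - m)‖ * ‖g₂ (k - m)‖ * ((∫ w, ‖s (m, w)‖ ∂torusMeasure n) * ‖f l‖) := fun l => by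
    simp only [hF, norm_mul, RCLike.norm_conj, norm_mFourier_apply, mul_one]
    rw [integral_const_mul, integral_mul_const]
  have hsum : Summable fun l => ∫ w, ‖F l w‖ ∂torusMeasure n := by
    have h1 := ((h₁.comp_injective (sub_left_injective (b := m))).mul_right ‖g₂ (k - m)‖).mul_right
      ((∫ w, ‖s (m, w)‖ ∂torusMeasure n) * ‖f‖)
    refine h1.of_nonneg_of_le (fun _ => by positivity) fun l => ?_
    rw [hn]
    simp only [Function.comp]
    have := lp.norm_apply_le_norm (by norm_num) f l
    gcongr
  have h := hasSum_integral_of_summable_integral_norm hint hsum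
  have he : ∀ w, ∑' l, F l w = s (m, w) * stft g₁ f (m, w) * tfShift (m, w) g₂ k := fun w => by
    rw [stft, ← tsum_mul_left, ← tsum_mul_right]
    refine tsum_congr fun l => ?_
    simp only [hF, tfShift, map_mul, conj_mFourier, sub_eq_add_neg k l, UnitAddTorus.mFourier_add]
    ring
  simp only [he] at h
  refine h.congr_fun fun l => ?_
  simp only [hF]
  rw [integral_const_mul, integral_mul_const]

theorem eq_locOp_of_hasSum {n : ℕ} {g₁ g₂ : Zn n → ℂ} (h₁ : Summable fun k => ‖g₁ k‖)
    {σ : temperedZT n} {s : Zn n × Tn n → ℂ}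
    (hs : MemLp s 1 (phaseMeasure n) ∨ MemLp s ⊤ (phaseMeasure n)) (hσ : IsGivenBy σ s)
    (f : ell2 n) (k : Zn n) {c : ℂ}
    (hc : HasSum (fun p : Zn n × Zn n => conj (g₁ p.1) * g₂ p.2 *
        (σ.1 (basisFn (k - p.2, p.2 - p.1)) * f (k + (p.1 - p.2)))) c) :
    c = locOp g₁ g₂ s f k := by
  let e : Zn n × Zn n ≃ Zn n × Zn n :=
    { toFun := fun q => (q.2 - q.1, k - q.1)
      invFun := fun p => (k - p.2, k + (p.1 - p.2))
      left_inv := fun q => by ext1 <;> simp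
      right_inv := fun p => by ext1 <;> simp }
  have h := (e.hasSum_iff.2 hc).prod_fiberwise fun m =>
    (hasSum_locOp_integral (g₂ := g₂) h₁ (integrable_slice hs m) f k).congr_fun fun l => by
      simp [e, apply_basisFn_of_isGivenBy hσ]
  exact h.tsum_eq.symm

theorem norm_basisFn_le_modNormZT {n : ℕ} {Φ : schwartzZT n} {q₀ : Zn n × Zn n}
    (hq₀ : fc Φ.1 q₀ ≠ 0) {p : ℝ≥0∞} (hp : 1 ≤ p) (hp' : p ≠ ⊤) (σ : modZT Φ p)
    (q : Zn n × Zn n) : ‖σ.1.1 (basisFn q)‖ ≤ ‖fc Φ.1 q₀‖⁻¹ * modNormZT Φ p σ.1 := by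
  have h := ENNReal.toReal_mono σ.2.2.ne (enorm_fc_mul_le_eLpNorm Φ σ.1 q₀ q hp hp')
  rw [ENNReal.toReal_mul, toReal_enorm, toReal_enorm] at h
  rw [← div_eq_inv_mul, le_div_iff₀' (norm_pos_iff.2 hq₀)]
  exact h

/-- The element of `M^p` with a single Fourier coefficient. -/
def basisMod {n : ℕ} (Φ : schwartzZT n) {p : ℝ≥0∞} (hp : 1 ≤ p) (q : Zn n × Zn n) : modZT Φ p :=
  ⟨basisDist q, basisDist_mem_modZT Φ q hp⟩

theorem memLp_top_basisFn {n : ℕ} (q : Zn n × Zn n) : MemLp (basisFn q).1 ⊤ (phaseMeasure n) := by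
  have hm : Measurable (basisFn q).1 :=
    measurable_from_prod_countable_right fun k => (continuous_schwartz (basisFn q) k).measurable
  refine memLp_top_of_bound hm.aestronglyMeasurable 1 (Filter.Eventually.of_forall fun a => ?_)
  rw [basisFn_apply]
  split_ifs
  · exact (norm_mFourier_apply _ _).le
  · simp

theorem tendsto_modNormZT_sub_sum {n : ℕ} {Φ : schwartzZT n} (hΦ : Φ ≠ 0) {p : ℝ≥0∞} (hp : 1 ≤ p)
    (hp' : p ≠ ⊤) (σ : modZT Φ p) :
    Filter.Tendsto (fun F : Finset (Zn n × Zn n) =>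
      modNormZT Φ p (σ - ∑ q ∈ F, σ.1.1 (basisFn q) • basisMod Φ hp q : modZT Φ p).1)
      Filter.atTop (nhds 0) := by
  classical
  have hr : 0 < p.toReal := ENNReal.toReal_pos (by positivity) hp'
  set B := ∑' q, ‖fc Φ.1 q‖ₑ with hB
  have hBt : B ≠ ⊤ := tsum_enorm_fc_ne_top Φ
  set a : Zn n × Zn n → ℝ≥0∞ := fun q => ‖σ.1.1 (basisFn q)‖ₑ ^ p.toReal with ha
  have hlim : Filter.Tendsto (fun F : Finset (Zn n × Zn n) =>
      B * (∑' q : {q // q ∉ F}, a q) ^ (1 / p.toReal)) Filter.atTop (nhds 0) := by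
    have h := ENNReal.tendsto_tsum_compl_atTop_zero (tsum_basisFn_rpow_ne_top hΦ hp hp' σ)
    have h1 := (ENNReal.continuous_rpow_const (y := 1 / p.toReal)).tendsto 0 |>.comp h
    rw [ENNReal.zero_rpow_of_pos (by positivity)] at h1
    have h2 := ENNReal.Tendsto.const_mul h1 (Or.inr hBt)
    rwa [mul_zero] at h2
  have hle : ∀ F : Finset (Zn n × Zn n), eLpNorm (stftZT Φ
      (σ - ∑ q ∈ F, σ.1.1 (basisFn q) • basisMod Φ hp q : modZT Φ p).1) p (doublePhaseMeasure n) ≤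
      B * (∑' q : {q // q ∉ F}, a q) ^ (1 / p.toReal) := fun F => by
    refine (eLpNorm_stftZT_le Φ _ hp hp').trans_eq ?_
    congr 2
    refine Eq.trans (tsum_congr fun q => ?_) (tsum_subtype {q | q ∉ F} a).symm
    have hu : (σ - ∑ q ∈ F, σ.1.1 (basisFn q) • basisMod Φ hp q : modZT Φ p).1.1 (basisFn q) =
        if q ∈ F then 0 else σ.1.1 (basisFn q) := by
      simp only [Submodule.coe_sub, Submodule.coe_sum, Submodule.coe_smul, LinearMap.sub_apply,
        LinearMap.sum_apply, LinearMap.smul_apply, basisMod, basisDist_apply, fc_basisFn,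
        smul_eq_mul, mul_ite, mul_one, mul_zero]
      by_cases hq : q ∈ F <;> simp [hq]
    rw [hu, Set.indicator_apply]
    by_cases hq : q ∈ F <;> simp [hq, ha, hr]
  have h0 := tendsto_of_tendsto_of_tendsto_of_le_of_le tendsto_const_nhds hlim
    (fun _ => zero_le) hle
  exact (ENNReal.tendsto_toReal ENNReal.zero_ne_top).comp h0

/-- Bounded linear maps on `M^p` that agree on the basis distributions are equal. -/
theorem eq_of_eq_basisMod {n : ℕ} {Φ : schwartzZT n} (hΦ : Φ ≠ 0) {p : ℝ≥0∞} (hp : 1 ≤ p)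
    (hp' : p ≠ ⊤) {𝓛 𝓛' : modZT Φ p →ₗ[ℂ] (ell2 n →L[ℂ] ell2 n)} (h : IsBoundedOnMod 𝓛)
    (h' : IsBoundedOnMod 𝓛') (he : ∀ q, 𝓛' (basisMod Φ hp q) = 𝓛 (basisMod Φ hp q)) :
    𝓛' = 𝓛 := by
  obtain ⟨K, hK⟩ := h
  obtain ⟨K', hK'⟩ := h'
  ext1 σ
  have hlim := (tendsto_modNormZT_sub_sum hΦ hp hp' σ).const_mul (K' + K)
  rw [mul_zero] at hlim
  have hle : ‖𝓛' σ - 𝓛 σ‖ ≤ 0 := by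
    refine ge_of_tendsto' hlim fun F => ?_
    set τ := ∑ q ∈ F, σ.1.1 (basisFn q) • basisMod Φ hp q
    have hτ : 𝓛' τ = 𝓛 τ := by simp [τ, map_sum, he]
    have h1 : 𝓛' σ - 𝓛 σ = 𝓛' (σ - τ) - 𝓛 (σ - τ) := by
      have h2 : 𝓛' (σ - τ) = 𝓛' σ - 𝓛' τ := map_sub 𝓛' σ τ
      have h3 : 𝓛 (σ - τ) = 𝓛 σ - 𝓛 τ := map_sub 𝓛 σ τ
      rw [h2, h3, hτ]
      abel
    rw [h1, add_mul]
    exact (norm_sub_le _ _).trans (add_le_add (hK' _) (hK _))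
  exact sub_eq_zero.1 (norm_le_zero_iff.1 hle)

theorem uniqueBoundedExtension {n : ℕ} {φ : Zn n → ℂ} (hφ : IsSchwartz φ) {j : Zn n}
    (hj : φ j ≠ 0) {Φ : schwartzZT n} {q₀ : Zn n × Zn n} (hq₀ : fc Φ.1 q₀ ≠ 0) {p : ℝ≥0∞}
    (hp : 1 ≤ p) (hp' : p ≠ ⊤) {g₁ g₂ : Zn n → ℂ} (hg₁ : MemMod φ 1 g₁) (hg₂ : MemMod φ 1 g₂) :
    UniqueBoundedExtension φ Φ (‖fc Φ.1 q₀‖⁻¹ * ‖φ j‖⁻¹ * ‖φ j‖⁻¹) p g₁ g₂ := by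
  have hΦ : Φ ≠ 0 := by
    rintro rfl
    exact hq₀ (by simp [fc])
  have h₁ := hg₁.summable_norm hφ hj
  have h₂ := hg₂.summable_norm hφ hj
  choose T hT hTf using fun σ : modZT Φ p =>
    exists_locOp h₁ h₂ (norm_basisFn_le_modNormZT hq₀ hp hp' σ)
  let 𝓛 : modZT Φ p →ₗ[ℂ] (ell2 n →L[ℂ] ell2 n) :=
    { toFun := T
      map_add' := fun σ τ => by
        ext f k
        refine (hTf (σ + τ) f k).unique (((hTf σ f k).add (hTf τ f k)).congr_fun fun q => ?_)
        simp only [Submodule.coe_add, LinearMap.add_apply]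
        ring
      map_smul' := fun c σ => by
        ext f k
        refine (hTf (c • σ) f k).unique (((hTf σ f k).mul_left c).congr_fun fun q => ?_)
        simp only [Submodule.coe_smul, LinearMap.smul_apply, smul_eq_mul]
        ring }
  have hext : ExtendsLocOp g₁ g₂ 𝓛 Set.univ := fun σ s _ hs hσ f k =>
    eq_locOp_of_hasSum h₁ hs hσ f k (hTf σ f k)
  have hbound : ∀ σ : modZT Φ p, ‖𝓛 σ‖ ≤ ‖fc Φ.1 q₀‖⁻¹ * ‖φ j‖⁻¹ * ‖φ j‖⁻¹ *
      modNormZT Φ p σ.1 * modNorm φ 1 g₁ * modNorm φ 1 g₂ := fun σ => by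
    have hm : 0 ≤ modNormZT Φ p σ.1 := ENNReal.toReal_nonneg
    have hm₁ : 0 ≤ modNorm φ 1 g₁ := ENNReal.toReal_nonneg
    have t₁ := hg₁.tsum_norm_le hφ hj
    have t₂ := hg₂.tsum_norm_le hφ hj
    have hz : 0 ≤ ∑' k, ‖g₂ k‖ := tsum_nonneg fun _ => norm_nonneg _
    calc ‖𝓛 σ‖ ≤ ‖fc Φ.1 q₀‖⁻¹ * modNormZT Φ p σ.1 * (∑' k, ‖g₁ k‖) * ∑' k, ‖g₂ k‖ := hT σ
      _ ≤ ‖fc Φ.1 q₀‖⁻¹ * modNormZT Φ p σ.1 * (‖φ j‖⁻¹ * modNorm φ 1 g₁) *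
          (‖φ j‖⁻¹ * modNorm φ 1 g₂) := by gcongr
      _ = _ := by ring
  refine ⟨𝓛, hext, hbound, fun 𝓛' hb hext' => ?_⟩
  have hb' : IsBoundedOnMod 𝓛 :=
    ⟨‖fc Φ.1 q₀‖⁻¹ * ‖φ j‖⁻¹ * ‖φ j‖⁻¹ * modNorm φ 1 g₁ * modNorm φ 1 g₂,
      fun σ => (hbound σ).trans_eq (by ring)⟩
  refine eq_of_eq_basisMod hΦ hp hp' hb' hb fun q => ?_
  ext f k
  rw [hext' (basisMod Φ hp q) _
        ⟨basisDist_mem_modZT Φ q le_rfl, basisDist_mem_modZT Φ q le_top⟩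
        (Or.inr (memLp_top_basisFn _)) (isGivenBy_basisDist q),
      hext (basisMod Φ hp q) _ trivial (Or.inr (memLp_top_basisFn _)) (isGivenBy_basisDist q)]

theorem isSchwartz_single {n : ℕ} (j : Zn n) (c : ℂ) : IsSchwartz (Pi.single j c) := by
  intro M
  refine ⟨(1 + ‖j‖) ^ M * ‖c‖, fun k => ?_⟩
  by_cases h : k = j
  · subst h
    simp
  · rw [Pi.single_eq_of_ne h, norm_zero, mul_zero]
    positivity

theorem eLpNorm_basisFn {n : ℕ} (q : Zn n × Zn n) {p : ℝ≥0∞} (h0 : p ≠ 0) (hp : p ≠ ⊤) :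
    eLpNorm (basisFn q).1 p (phaseMeasure n) = 1 := by
  have hr : 0 < p.toReal := ENNReal.toReal_pos h0 hp
  have hm : Measurable (basisFn q).1 :=
    measurable_from_prod_countable_right fun k => (continuous_schwartz (basisFn q) k).measurable
  rw [eLpNorm_eq_lintegral_rpow_enorm_toReal h0 hp, phaseMeasure,
    lintegral_prod _ (hm.enorm.pow_const _).aemeasurable, lintegral_count, tsum_eq_single q.1]
  · simp [basisFn_apply, ← ofReal_norm, norm_mFourier_apply]
  · intro k hk
    simp [basisFn_apply, hk, hr]

theorem eLpNorm_single_one {n : ℕ} (j : Zn n) {p : ℝ≥0∞} (h0 : p ≠ 0) (hp : p ≠ ⊤) :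
    eLpNorm (Pi.single j 1 : Zn n → ℂ) p Measure.count = 1 := by
  have hr : 0 < p.toReal := ENNReal.toReal_pos h0 hp
  rw [eLpNorm_eq_lintegral_rpow_enorm_toReal h0 hp, lintegral_count, tsum_eq_single j]
  · simp
  · intro k hk
    simp [hk, hr]

end LocOp

end

theorem mainTheorem1 (n : ℕ) :
    (∀ φ : LocOp.Zn n → ℂ, LocOp.IsSchwartz φ → φ ≠ 0 →
      ∀ Φ : LocOp.schwartzZT n, Φ ≠ 0 →
        ∃ C : ℝ, 0 < C ∧ ∀ p : ℝ≥0∞, 1 < p → p < ⊤ →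
          ∀ g₁ g₂ : LocOp.Zn n → ℂ, LocOp.MemMod φ 1 g₁ → LocOp.MemMod φ 1 g₂ →
            LocOp.UniqueBoundedExtension φ Φ C p g₁ g₂) ∧
    (∃ (φ : LocOp.Zn n → ℂ) (Φ : LocOp.schwartzZT n),
      LocOp.IsSchwartz φ ∧
      eLpNorm φ 2 Measure.count = 1 ∧
      eLpNorm Φ.1 2 (LocOp.phaseMeasure n) = 1 ∧
      eLpNorm Φ.1 1 (LocOp.phaseMeasure n) ≤ 1 ∧
      ∀ p : ℝ≥0∞, 1 < p → p < ⊤ →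
        ∀ g₁ g₂ : LocOp.Zn n → ℂ, LocOp.MemMod φ 1 g₁ → LocOp.MemMod φ 1 g₂ →
          LocOp.UniqueBoundedExtension φ Φ 1 p g₁ g₂) := by
  refine ⟨fun φ hφ h0 Φ hΦ => ?_, Pi.single 0 1, LocOp.basisFn 0, LocOp.isSchwartz_single 0 1,
    LocOp.eLpNorm_single_one 0 (by norm_num) (by norm_num),
    LocOp.eLpNorm_basisFn 0 (by norm_num) (by norm_num),
    (LocOp.eLpNorm_basisFn 0 one_ne_zero ENNReal.one_ne_top).le,
    fun p hp hp' g₁ g₂ hg₁ hg₂ => ?_⟩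
  · obtain ⟨j, hj⟩ := Function.ne_iff.1 h0
    obtain ⟨q₀, hq₀⟩ := LocOp.exists_fc_ne_zero hΦ
    have hj' : φ j ≠ 0 := hj
    refine ⟨‖LocOp.fc Φ.1 q₀‖⁻¹ * ‖φ j‖⁻¹ * ‖φ j‖⁻¹, by positivity,
      fun p hp hp' g₁ g₂ hg₁ hg₂ => ?_⟩
    exact LocOp.uniqueBoundedExtension hφ hj' hq₀ hp.le hp'.ne hg₁ hg₂
  · have hfc : LocOp.fc (LocOp.basisFn (0 : LocOp.Zn n × LocOp.Zn n)).1 0 = 1 := by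
      simp [LocOp.fc_basisFn]
    have h := LocOp.uniqueBoundedExtension (LocOp.isSchwartz_single 0 1) (j := 0) (by simp)
      (Φ := LocOp.basisFn 0) (q₀ := 0) (by simp [hfc]) hp.le hp'.ne hg₁ hg₂
    simpa [hfc] using h
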